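/- Let $k$ be a field of characteristic zero. A Lie algebra with triangular decomposition is a five-tuple $(\mathfrak g,\mathfrak h_0,\mathfrak h,\mathfrak g_+,\omega)$, where $\mathfrak g$ is a Lie algebra over $k$, $\mathfrak h_0\subset\mathfrak h$ are abelian subalgebras, $\mathfrak g_+$ is a subalgebra, and $\omega$ is a linear map $\mathfrak g\to\mathfrak g$ with $\omega^2=\mathrm{id}$ and $\omega([x,y])=[\omega(y),\omega(x)]$, such that: (i) $\mathfrak g=\mathfrak g_-\oplus\mathfrak h\oplus\mathfrak g_+$ with $\mathfrak g_-=\omega(\mathfrak g_+)$, and $\omega|_{\mathfrak h}=\mathrm{id}$; (ii) under the adjoint action of $\mathfrak h_0$, $\mathfrak g_+$ is the direct sum of its weight spaces; these are finite-dimensional, and the set $\Delta_+\subset\mathfrak h_0^*$ of weights does not contain $0$; (iii) the additive monoid $Q_+\subset\mathfrak h_0^*$ generated by $\Delta_+$ is generated by a linearly independent set. Let $\Delta=\Delta_+\cup(-\Delta_+)$, and write $\mathfrak g^\alpha=\{x\in\mathfrak g : [a,x]=\alpha(a)x \text{ for all } a\in\mathfrak h_0\}$. The decomposition has a non-degenerate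 pairing if for each $\alpha\in\Delta$ there are given a non-zero $h_\alpha\in\mathfrak h$ and a non-degenerate bilinear form $(\cdot|\cdot)_\alpha$ on $\mathfrak g^\alpha$ such that $[x,\omega(y)]=(x|y)_\alpha h_\alpha$ for all $x,y\in\mathfrak g^\alpha$. Let $N\ge 1$ be an integer and let $\hat{\mathfrak g}=\mathfrak g\otimes_k k[t]/t^{N+1}k[t]$ with bracket $[x\otimes t^i,y\otimes t^j]=[x,y]\otimes t^{i+j}$; define $\hat{\mathfrak h}$ and $\hat{\mathfrak g}_+$ in the same way from $\mathfrak h$ and $\mathfrak g_+$, and regard $\mathfrak h_0$ as a subspace of $\hat{\mathfrak h}$ via $a\mapsto a\otimes t^0$. For $\Lambda\in\hat{\mathfrak h}^*$ let $M(\Lambda)=U(\hat{\mathfrak g})\otimes_{U(\hat{\mathfrak h}\oplus\hat{\mathfrak g}_+)}k_\Lambda$ be the Verma module, where $\hat{\mathfrak g}_+$ acts on the line $k_\Lambda$ by $0$ and $\hat{\mathfrak h}$ acts by $\Lambda$. A vector $v\in M(\Lambda)$ is a primitive vector of weight $\mu\in\mathfrak h_0^*$ if $a\cdot v=\mu(a)v$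 for all $a\in\mathfrak h_0$ and the submodule $U(\hat{\mathfrak g})v$ is proper. A module is reducible if it has a non-zero proper submodule. **Theorem.** Let $(\mathfrak g,\mathfrak h_0,\mathfrak h,\mathfrak g_+,\omega)$ be a Lie algebra with triangular decomposition and non-degenerate pairing, let $N\ge1$ and let $\Lambda\in\hat{\mathfrak h}^*$. 1. For every $\chi\in Q_+$, the Verma module $M(\Lambda)$ contains a non-zero primitive vector of weight $\Lambda|_{\mathfrak h_0}-\chi$ if and only if $\Lambda(h_\alpha\otimes t^N)=0$ for some $\alpha\in\Delta_+$ with $\chi-\alpha\in Q_+$. 2. $M(\Lambda)$ is reducible if and only if $\Lambda(h_\alpha\otimes t^N)=0$ for some $\alpha\in\Delta$; equivalently, if and only if this holds for some $\alpha\in\Delta_+$. -/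

import Mathlib

open scoped TensorProduct Polynomial

/-- The `α`-weight space of `𝔤` under the adjoint action of a subalgebra `𝔥₀`. -/
def adWeightSpace {k g : Type*} [Field k] [LieRing g] [LieAlgebra k g]
    (h₀ : LieSubalgebra k g) (α : Module.Dual k h₀) : Submodule k g where
  carrier := {x | ∀ a : h₀, ⁅(a : g), x⁆ = α a • x}
  add_mem' hx hy a := by rw [lie_add, hx a, hy a, smul_add]
  zero_mem' a := by simp
  smul_mem' c x hx a := by rw [lie_smul, hx a, smul_comm]

/-- A Lie algebra with triangular decomposition, given by the five-tuple `(𝔤, 𝔥₀, 𝔥, 𝔤₊, ω)`.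
The negative part is `𝔤₋ = ω(𝔤₊)`. -/
structure TriangularDecomposition (k g : Type*) [Field k] [LieRing g] [LieAlgebra k g] where
  /-- the subalgebra whose functionals are the weights -/
  h₀ : LieSubalgebra k g
  /-- the Cartan part -/
  h : LieSubalgebra k g
  /-- the positive part -/
  pos : LieSubalgebra k g
  /-- the anti-involution -/
  ω : g →ₗ[k] g
  h₀_le_h : h₀ ≤ h
  h_abelian : ∀ x ∈ h, ∀ y ∈ h, ⁅x, y⁆ = 0
  ω_ω : ∀ x, ω (ω x) = x
  ω_lie : ∀ x y, ω ⁅x, y⁆ = ⁅ω y, ω x⁆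
  ω_h : ∀ x ∈ h, ω x = x
  /-- `𝔤 = 𝔤₋ ⊕ 𝔥 ⊕ 𝔤₊` -/
  isInternal : DirectSum.IsInternal
    ![pos.toSubmodule.map ω, h.toSubmodule, pos.toSubmodule]
  /-- `𝔤₊` is a weight module for `𝔥₀` under the adjoint action -/
  pos_weight : pos.toSubmodule ≤ ⨆ α : Module.Dual k h₀, adWeightSpace h₀ α ⊓ pos.toSubmodule
  /-- the weights of `𝔤₊` are non-zero -/
  pos_weight_ne_zero : adWeightSpace h₀ 0 ⊓ pos.toSubmodule = ⊥
  /-- the weight spaces of `𝔤₊` are finite-dimensional -/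
  pos_finite : ∀ α : Module.Dual k h₀,
    FiniteDimensional k ↥(adWeightSpace h₀ α ⊓ pos.toSubmodule)
  /-- the additive monoid generated by the weights of `𝔤₊` is freely generated by a linearly
  independent set of functionals -/
  exists_base : ∃ S : Set (Module.Dual k h₀), LinearIndepOn k id S ∧
    AddSubmonoid.closure S =
      AddSubmonoid.closure {α | adWeightSpace h₀ α ⊓ pos.toSubmodule ≠ ⊥}

namespace TriangularDecomposition

variable {k g : Type*} [Field k] [LieRing g] [LieAlgebra k g] (T : TriangularDecomposition k g)

/-- The positive roots `Δ₊`: the weights of the `𝔥₀`-module `𝔤₊`. -/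
def posRoots : Set (Module.Dual k T.h₀) :=
  {α | adWeightSpace T.h₀ α ⊓ T.pos.toSubmodule ≠ ⊥}

/-- The roots `Δ = Δ₊ ∪ -Δ₊`. -/
def roots : Set (Module.Dual k T.h₀) := {α | α ∈ T.posRoots ∨ -α ∈ T.posRoots}

/-- `Q₊`, the additive monoid generated by the positive roots. -/
def posCone : AddSubmonoid (Module.Dual k T.h₀) := AddSubmonoid.closure T.posRoots

/-- The root space `𝔤^α`: the `α`-weight space of `𝔤` under the adjoint action of `𝔥₀`. -/
abbrev rootSpace (α : Module.Dual k T.h₀) : Submodule k g := adWeightSpace T.h₀ α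

/-- A non-degenerate pairing: for each root `α`, a non-zero element `h_α ∈ 𝔥` and a
non-degenerate bilinear form on `𝔤^α` such that `[x, ω y] = (x | y)_α h_α`. -/
structure NondegeneratePairing where
  /-- the elements `h_α` -/
  hElt : T.roots → T.h
  /-- the forms `(· | ·)_α` -/
  form : ∀ α : T.roots, LinearMap.BilinForm k (T.rootSpace α)
  hElt_ne_zero : ∀ α, hElt α ≠ 0
  form_nondegenerate : ∀ α, (form α).Nondegenerate
  lie_ω : ∀ (α : T.roots) (x y : T.rootSpace α),
    ⁅(x : g), T.ω (y : g)⁆ = form α x y • (hElt α : g)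

end TriangularDecomposition

/-- The algebra `k[t] / t^(N+1) k[t]`. -/
abbrev TruncatedPoly (k : Type*) [Field k] (N : ℕ) : Type _ :=
  k[X] ⧸ Ideal.span {(Polynomial.X : k[X]) ^ (N + 1)}

/-- The class of `t ^ d` in `k[t] / t^(N+1) k[t]`. -/
noncomputable def TruncatedPoly.tPow (k : Type*) [Field k] (N d : ℕ) : TruncatedPoly k N :=
  Ideal.Quotient.mk _ ((Polynomial.X : k[X]) ^ d)

/-- The truncated current Lie algebra `ĝ`, with the coefficient algebra written as the left
tensor factor and the bracket `[a ⊗ x, b ⊗ y] = ab ⊗ [x, y]`, as a Lie algebra over `k`. -/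
abbrev TruncatedCurrent (k g : Type*) [Field k] [LieRing g] [LieAlgebra k g] (N : ℕ) : Type _ :=
  TruncatedPoly k N ⊗[k] g

namespace TruncatedCurrent

variable {k g : Type*} [Field k] [LieRing g] [LieAlgebra k g]

/-- The subspace `V̂ = V ⊗ k[t] / t^(N+1) k[t]` of `ĝ`, for a subspace `V` of `𝔤`. -/
noncomputable def hat (N : ℕ) (V : Submodule k g) : Submodule k (TruncatedCurrent k g N) :=
  Submodule.span k {z | ∃ (a : TruncatedPoly k N) (x : g), x ∈ V ∧ z = a ⊗ₜ[k] x}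

/-- The element `x ⊗ t ^ d` of `V̂`, for `x ∈ V`. -/
noncomputable def hatElt (N : ℕ) {V : Submodule k g} (x : V) (d : ℕ) : hat N V :=
  ⟨TruncatedPoly.tPow k N d ⊗ₜ[k] (x : g), Submodule.subset_span ⟨_, _, x.2, rfl⟩⟩

end TruncatedCurrent

section Verma

variable {k L : Type*} [Field k] [LieRing L] [LieAlgebra k L]

/-- The left ideal of `U(L)` generated by `𝔫` and by all `x - Λ(x)` with `x ∈ 𝔥`. -/
def vermaIdeal (𝔥 𝔫 : Submodule k L) (Λ : Module.Dual k 𝔥) :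
    Submodule (UniversalEnvelopingAlgebra k L) (UniversalEnvelopingAlgebra k L) :=
  Submodule.span _
    ({u | ∃ x ∈ 𝔫, u = UniversalEnvelopingAlgebra.ι k x} ∪
      {u | ∃ x : 𝔥, u = UniversalEnvelopingAlgebra.ι k (x : L) -
        algebraMap k (UniversalEnvelopingAlgebra k L) (Λ x)})

/-- The Verma module of highest weight `Λ`, that is the module induced from the one-dimensional
module of `𝔥 ⊕ 𝔫` on which `𝔫` acts by zero and `𝔥` acts by `Λ`. It is presented as the quotient
of `U(L)` by the left ideal generated by the defining relations of the generator. -/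
abbrev VermaModule (𝔥 𝔫 : Submodule k L) (Λ : Module.Dual k 𝔥) : Type _ :=
  UniversalEnvelopingAlgebra k L ⧸ vermaIdeal 𝔥 𝔫 Λ

end Verma

/-- A module is reducible if it has a non-zero proper submodule. -/
def IsReducibleModule (U M : Type*) [Ring U] [AddCommGroup M] [Module U M] : Prop :=
  ∃ W : Submodule U M, W ≠ ⊥ ∧ W ≠ ⊤

namespace TriangularDecomposition

variable {k g : Type*} [Field k] [LieRing g] [LieAlgebra k g] (T : TriangularDecomposition k g)

/-- `ĥ = 𝔥 ⊗ k[t] / t^(N+1) k[t]`. -/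
noncomputable abbrev hHat (N : ℕ) : Submodule k (TruncatedCurrent k g N) :=
  TruncatedCurrent.hat N T.h.toSubmodule

/-- The Verma module `M(Λ)` of `ĝ` for its triangular decomposition `(ĝ, 𝔥₀, ĥ, ĝ₊, ω)`. -/
abbrev CurrentVerma (N : ℕ) (Λ : Module.Dual k (T.hHat N)) : Type _ :=
  VermaModule (k := k) (L := TruncatedCurrent k g N) (T.hHat N)
    (TruncatedCurrent.hat N T.pos.toSubmodule) Λ

/-- The restriction `Λ|_{𝔥₀}`, where `𝔥₀` is embedded in `ĥ` by `x ↦ x ⊗ t ^ 0`. -/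
noncomputable def restrictWeight (N : ℕ) (Λ : Module.Dual k (T.hHat N)) :
    Module.Dual k T.h₀ where
  toFun a := Λ (TruncatedCurrent.hatElt N (⟨a, T.h₀_le_h a.2⟩ : T.h) 0)
  map_add' a b := by
    rw [← map_add]
    exact congrArg Λ (Subtype.ext (TensorProduct.tmul_add _ _ _))
  map_smul' c a := by
    rw [RingHom.id_apply, ← map_smul]
    exact congrArg Λ (Subtype.ext (TensorProduct.tmul_smul _ _ _))

section

variable {N : ℕ} {M : Type*} [AddCommGroup M] [Module k M]
  [Module (UniversalEnvelopingAlgebra k (TruncatedCurrent k g N)) M]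

/-- `v` lies in the `μ`-weight space `M^μ` of the `ĝ`-module `M`: each `x ∈ 𝔥₀`, embedded as
`x ⊗ t ^ 0`, acts on `v` by `μ(x)`. -/
def MemWeightSpace (μ : Module.Dual k T.h₀) (v : M) : Prop :=
  ∀ a : T.h₀, UniversalEnvelopingAlgebra.ι k
    ((TruncatedPoly.tPow k N 0 ⊗ₜ[k] (a : g) : TruncatedCurrent k g N)) • v = μ a • v

/-- `v` is a primitive vector of weight `μ`: it has weight `μ` and `U(ĝ) v` is proper. -/
def IsPrimitiveVector (μ : Module.Dual k T.h₀) (v : M) : Prop :=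
  T.MemWeightSpace (N := N) μ v ∧
    Submodule.span (UniversalEnvelopingAlgebra k (TruncatedCurrent k g N)) {v} ≠ ⊤

end

end TriangularDecomposition

/-!
By a Poincaré–Birkhoff–Witt theorem for induced modules, `M(Λ)` has as basis the monomials `z_F`,
where `F` runs over the multisets of basis vectors of `ĝ₋`. It is proved directly: the action on
the span of the monomials is built by recursion on the degree (`act_lie_mono`, `rep`), and
`fromMono_rep` and `exists_vermaEquiv` identify the result with the Verma module. In this model a
submodule is proper exactly when the coefficient of the highest weight vector `z_0` vanishes on it,
since `𝔥₀` separates `z_0` from the other monomials.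

The mechanism is a degree on `ĝ`, namely `2m + 1 - 2N` on `𝔤₋ ⊗ t^m`, `2m - 2N` on `𝔥 ⊗ t^m` and
`2m - 1` on `𝔤₊ ⊗ t^m`. The action respects the filtration of `M(Λ)` by the degree of monomials,
and to leading order `ĝ` acts like a Heisenberg algebra on a polynomial ring
(`rep_sub_symbolMono_mem`): elements of `ĝ₋` multiply by variables, and elements `e` of `ĝ₊` act by
the derivation that sends the variable `z_f` to `Λ([e, f])`. Brackets of `𝔤₊ ⊗ t^m` and `𝔤₋ ⊗ t^l`
with `m + l = N` contribute the values of `Λ` on `𝔥 ⊗ t^N`, so for dual bases of the root spaces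
`x' ⊗ t^(N-m)` is `Λ(h_α ⊗ t^N)` times the partial derivative with respect to the variable
`ω(x) ⊗ t^m`, up to terms of higher degree and derivatives along variables of smaller degree.

Pair `M(Λ)` with monomials in the dual basis, taken with the exponents `m` replaced by `N - m`, by
means of the anti-involution `ω` and the coefficient of `z_0`. The matrix of this contravariant
pairing is then triangular with respect to the degree (`pairing_eq_zero_of_lt`), and diagonal on
monomials of equal degree, with entry at `z_F` a positive integer times the product of the
`Λ(h_α ⊗ t^N)` over the elements of `F` (`pairing_mono`).

If `v ≠ 0` generates a proper submodule, then the diagonal entry at a monomial of least degree in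
`v` vanishes (`exists_map_lie_star_eq_zero`). Conversely, if the entry at `F` vanishes, consider the
vectors supported on `F` and on the monomials of the same weight and larger degree; only the
monomials of larger degree impose conditions on them, so there are more unknowns than equations, and
a non-zero vector of this form lies in the radical
(`exists_mem_wtSpace_of_map_lie_star_eq_zero`). Finally `h_α` and `h_{-α}` are proportional, which
extends the criterion from positive roots to all roots (`map_hElt_neg_eq_zero`).
-/

/-! ### A Poincaré–Birkhoff–Witt theorem for induced modules -/

/-- A non-empty multiset is its least element together with the rest. -/
theorem Multiset.exists_eq_cons_le {ι : Type*} [LinearOrder ι] {M : Multiset ι} (hM : M ≠ 0) :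
    ∃ p : ι × Multiset ι, M = p.1 ::ₘ p.2 ∧ ∀ t ∈ p.2, p.1 ≤ t := by
  obtain ⟨j, hj, hmin⟩ := M.toFinset.exists_min_image id
    (by simpa [Finset.nonempty_iff_ne_empty] using hM)
  refine ⟨(j, M.erase j), (Multiset.cons_erase (by simpa using hj)).symm, fun t ht => ?_⟩
  exact hmin t (by simpa using Multiset.mem_of_mem_erase ht)

theorem Multiset.cons_eq_cons_of_le {ι : Type*} [LinearOrder ι] {j j' : ι} {T T' : Multiset ι}
    (h : j ::ₘ T = j' ::ₘ T') (hT : ∀ t ∈ T, j ≤ t) (hT' : ∀ t ∈ T', j' ≤ t) :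
    j = j' ∧ T = T' := by
  have hj : j = j' := by
    apply le_antisymm
    · have : j' ∈ j ::ₘ T := h ▸ Multiset.mem_cons_self _ _
      rcases Multiset.mem_cons.1 this with h | h
      exacts [h.ge, hT _ h]
    · have : j ∈ j' ::ₘ T' := h ▸ Multiset.mem_cons_self _ _
      rcases Multiset.mem_cons.1 this with h | h
      exacts [h.ge, hT' _ h]
  subst hj
  exact ⟨rfl, (Multiset.cons_inj_right _).1 h⟩

/-- A linear map sends the span of a set of monomials into a subspace as soon as it sends those
monomials there. -/
theorem Finsupp.map_mem_of_mem_supported {k α V : Type*} [Field k] [AddCommGroup V] [Module k V]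
    (f : (α →₀ k) →ₗ[k] V) {s : Set α} {Q : Submodule k V}
    (h : ∀ M ∈ s, f (Finsupp.single M 1) ∈ Q) {w : α →₀ k} (hw : w ∈ Finsupp.supported k k s) :
    f w ∈ Q := by
  rw [Finsupp.supported_eq_span_single] at hw
  have : Submodule.span k ((fun i => Finsupp.single i (1 : k)) '' s) ≤ Q.comap f := by
    rw [Submodule.span_le]
    rintro _ ⟨M, hM, rfl⟩
    exact h M hM
  exact this hw

theorem Module.Basis.induction_on' {k V α : Type*} [Field k] [AddCommGroup V] [Module k V]
    (b : Module.Basis α k V) {p : V → Prop} (zero : p 0) (add : ∀ x y, p x → p y → p (x + y))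
    (smul : ∀ (c : k) x, p x → p (c • x)) (basis : ∀ i, p (b i)) (x : V) : p x := by
  have hx : x ∈ Submodule.span k (Set.range b) := by simp
  induction hx using Submodule.span_induction with
  | mem x hx => obtain ⟨i, rfl⟩ := hx; exact basis i
  | zero => exact zero
  | add x y _ _ hx hy => exact add x y hx hy
  | smul c x _ hx => exact smul c x hx

namespace InducedModule

attribute [local instance] LieRing.ofAssociativeRing

variable {k L ι ι' : Type*} [Field k] [LieRing L] [LieAlgebra k L]

/-- The monomial `z_M` attached to a multiset `M` of variables. -/
noncomputable abbrev mono (k : Type*) [Field k] (M : Multiset ι) : Multiset ι →₀ k :=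
  Finsupp.single M 1

/-- The monomials of degree at most `n` span this subspace. -/
noncomputable abbrev degLE (k ι : Type*) [Field k] (n : ℕ) : Submodule k (Multiset ι →₀ k) :=
  Finsupp.supported k k {M | M.card ≤ n}

theorem degLE_mono {n m : ℕ} (h : n ≤ m) : degLE k ι n ≤ degLE k ι m :=
  Finsupp.supported_mono fun _ hM => le_trans hM h

theorem mono_mem_degLE {M : Multiset ι} {n : ℕ} (h : M.card ≤ n) : mono k M ∈ degLE k ι n :=
  Finsupp.single_mem_supported k _ h

/-- An identity between bilinear actions may be checked on basis vectors. -/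
theorem apply_eq_of_basis {α V : Type*} [AddCommGroup V] [Module k V]
    {b : Module.Basis α k L}
    {f g : L →ₗ[k] V} (h : ∀ i, f (b i) = g (b i)) (x : L) : f x = g x := by
  rw [b.ext h]

variable [LinearOrder ι]

/-- The leading term of the action of a basis vector on `z_M`: multiplication by the variable for
a basis vector of the complement, and `0` for one of the subalgebra. -/
noncomputable def lead (k : Type*) [Field k] (i : ι ⊕ ι') (M : Multiset ι) : Multiset ι →₀ k :=
  i.elim (fun i => mono k (i ::ₘ M)) fun _ => 0

/-- The index `i` belongs to the complement and is at most every element of `M`. -/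
def LeAll (i : ι ⊕ ι') (M : Multiset ι) : Prop :=
  ∃ i₀, i = Sum.inl i₀ ∧ ∀ t ∈ M, i₀ ≤ t

/-- The data needed to induce a one-dimensional module from the subalgebra spanned by the basis
vectors with index in `ι'`: the functional `Λ` vanishes on the complement and restricts to a
character of the subalgebra. -/
structure IsCharacterDatum (b : Module.Basis (ι ⊕ ι') k L) (Λ : L →ₗ[k] k) : Prop where
  map_inl : ∀ i, Λ (b (Sum.inl i)) = 0
  lie_mem : ∀ i j, ⁅b (Sum.inr i), b (Sum.inr j)⁆ ∈
    Submodule.span k (Set.range fun l => b (Sum.inr l))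
  map_lie : ∀ i j, Λ ⁅b (Sum.inr i), b (Sum.inr j)⁆ = 0

variable (b : Module.Basis (ι ⊕ ι') k L) (Λ : L →ₗ[k] k)

open Classical in
/-- One step of the recursion that defines the action of `b i` on `z_M`, given the action `R` on
monomials of smaller degree. -/
noncomputable def step (R : L →ₗ[k] (Multiset ι →₀ k) →ₗ[k] (Multiset ι →₀ k)) (i : ι ⊕ ι')
    (M : Multiset ι) : Multiset ι →₀ k :=
  if h : M = 0 then lead k i M + Λ (b i) • mono k M
  else if LeAll i M then lead k i M
  else
    let p := (Multiset.exists_eq_cons_le h).choose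
    lead k i M + R (b (Sum.inl p.1)) (R (b i) (mono k p.2) - lead k i p.2) +
      R ⁅b i, b (Sum.inl p.1)⁆ (mono k p.2)

/-- The action of the Lie algebra on monomials of degree less than `n`; on monomials of larger
degree the value is of no significance. -/
noncomputable def actAux : ℕ → L →ₗ[k] (Multiset ι →₀ k) →ₗ[k] (Multiset ι →₀ k)
  | 0 => 0
  | n + 1 => b.constr k fun i => Finsupp.linearCombination k (step b Λ (actAux n) i)

variable {b Λ}

theorem actAux_succ_mono (n : ℕ) (i : ι ⊕ ι') (M : Multiset ι) :
    actAux b Λ (n + 1) (b i) (mono k M) = step b Λ (actAux b Λ n) i M := by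
  rw [actAux, Module.Basis.constr_basis, Finsupp.linearCombination_single, one_smul]

theorem step_zero (R : L →ₗ[k] (Multiset ι →₀ k) →ₗ[k] (Multiset ι →₀ k)) (i : ι ⊕ ι') :
    step b Λ R i 0 = lead k i 0 + Λ (b i) • mono k 0 := by
  rw [step, dif_pos rfl]

theorem step_of_leAll (hb : IsCharacterDatum b Λ)
    (R : L →ₗ[k] (Multiset ι →₀ k) →ₗ[k] (Multiset ι →₀ k)) {i : ι ⊕ ι'}
    {M : Multiset ι} (h : LeAll i M) : step b Λ R i M = lead k i M := by
  by_cases hM : M = 0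
  · subst hM
    obtain ⟨i, rfl, -⟩ := h
    rw [step_zero, hb.map_inl, zero_smul, add_zero]
  · rw [step, dif_neg hM, if_pos h]

theorem step_cons (R : L →ₗ[k] (Multiset ι →₀ k) →ₗ[k] (Multiset ι →₀ k)) {i : ι ⊕ ι'} {j : ι}
    {T : Multiset ι} (hT : ∀ t ∈ T, j ≤ t) (h : ¬ LeAll i (j ::ₘ T)) :
    step b Λ R i (j ::ₘ T) = lead k i (j ::ₘ T) +
      R (b (Sum.inl j)) (R (b i) (mono k T) - lead k i T) +
        R ⁅b i, b (Sum.inl j)⁆ (mono k T) := by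
  have hne : j ::ₘ T ≠ 0 := Multiset.cons_ne_zero
  rw [step, dif_neg hne, if_neg h]
  obtain ⟨h1, h2⟩ := (Multiset.exists_eq_cons_le hne).choose_spec
  obtain ⟨e1, e2⟩ := Multiset.cons_eq_cons_of_le h1 hT h2
  simp only [← e1, ← e2]

omit [LinearOrder ι] in
theorem lead_mem_degLE (i : ι ⊕ ι') (M : Multiset ι) : lead k i M ∈ degLE k ι (M.card + 1) := by
  rcases i with i | i
  · exact mono_mem_degLE (by simp)
  · exact zero_mem _

theorem actAux_spec (hb : IsCharacterDatum b Λ) (n : ℕ) : ∀ M : Multiset ι, M.card < n → ∀ i,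
    actAux b Λ (n + 1) (b i) (mono k M) = actAux b Λ n (b i) (mono k M) ∧
      actAux b Λ n (b i) (mono k M) - lead k i M ∈ degLE k ι M.card := by
  induction n with
  | zero => intro M hM; omega
  | succ n ih =>
    intro M hM i
    rw [actAux_succ_mono, actAux_succ_mono]
    by_cases h0 : M = 0
    · subst h0
      simp only [step_zero, true_and, add_sub_cancel_left]
      exact Submodule.smul_mem _ _ (mono_mem_degLE (by simp))
    by_cases hle : LeAll i M
    · simp [step_of_leAll hb _ hle]
    obtain ⟨⟨j, T⟩, rfl, hT⟩ := Multiset.exists_eq_cons_le h0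
    have hcard : T.card < n := by simpa using hM
    -- the two actions agree, and raise the degree by at most one, in degrees less than `n`
    have hst : ∀ x : L, ∀ w ∈ degLE k ι T.card,
        actAux b Λ (n + 1) x w = actAux b Λ n x w ∧ actAux b Λ n x w ∈ degLE k ι (T.card + 1) := by
      intro x w hw
      constructor
      · rw [← sub_eq_zero, ← LinearMap.sub_apply]
        refine (Submodule.mem_bot k).1 (Finsupp.map_mem_of_mem_supported _ (fun M' hM' => ?_) hw)
        rw [Submodule.mem_bot, LinearMap.sub_apply, sub_eq_zero]
        exact apply_eq_of_basis (b := b) (f := (actAux b Λ (n + 1)).flip (mono k M'))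
          (g := (actAux b Λ n).flip (mono k M'))
          (fun l => (ih M' (lt_of_le_of_lt hM' hcard) l).1) x
      · refine Finsupp.map_mem_of_mem_supported _ (fun M' hM' => ?_) hw
        induction x using b.induction_on' with
        | zero => simp
        | add x y hx hy => simpa using add_mem hx hy
        | smul c x hx => simpa using Submodule.smul_mem _ c hx
        | basis l =>
          have h1 := (ih M' (lt_of_le_of_lt hM' hcard) l).2
          have h2 := add_mem (degLE_mono (Nat.le_succ _) h1) (lead_mem_degLE (k := k) l M')
          rw [sub_add_cancel] at h2
          exact degLE_mono (Nat.succ_le_succ hM') h2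
    have hTm : mono k T ∈ degLE k ι T.card := mono_mem_degLE le_rfl
    have hw := (ih T hcard i).2
    rw [step_cons _ hT hle, step_cons _ hT hle, (hst _ _ hTm).1, (hst _ _ hTm).1, (hst _ _ hw).1]
    refine ⟨rfl, ?_⟩
    rw [add_assoc, add_sub_cancel_left, Multiset.card_cons]
    exact add_mem (hst _ _ hw).2 (hst _ _ hTm).2

variable (b Λ) in
/-- The action of the Lie algebra on the module with basis the monomials `z_M`. -/
noncomputable def act : L →ₗ[k] (Multiset ι →₀ k) →ₗ[k] (Multiset ι →₀ k) :=
  (Finsupp.linearCombination k fun M : Multiset ι =>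
    (actAux b Λ (M.card + 1)).flip (mono k M)).flip

theorem act_mono (x : L) (M : Multiset ι) :
    act b Λ x (mono k M) = actAux b Λ (M.card + 1) x (mono k M) := by
  simp [act]

theorem act_mono_of_lt (hb : IsCharacterDatum b Λ) (x : L) {M : Multiset ι} {n : ℕ}
    (hM : M.card < n) : actAux b Λ n x (mono k M) = act b Λ x (mono k M) := by
  rw [act_mono]
  refine apply_eq_of_basis (b := b) (f := (actAux b Λ n).flip (mono k M))
    (g := (actAux b Λ (M.card + 1)).flip (mono k M)) (fun i => ?_) x
  simp only [LinearMap.flip_apply]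
  obtain ⟨m, rfl⟩ := Nat.exists_eq_add_of_le (Nat.succ_le_of_lt hM)
  induction m with
  | zero => rfl
  | succ m ih => exact (actAux_spec hb (M.card + 1 + m) M (by omega) i).1.trans (ih (by omega))

theorem act_of_lt (hb : IsCharacterDatum b Λ) (x : L) {n m : ℕ} (h : m < n)
    {w : Multiset ι →₀ k} (hw : w ∈ degLE k ι m) : actAux b Λ n x w = act b Λ x w := by
  rw [← sub_eq_zero, ← LinearMap.sub_apply]
  refine (Submodule.mem_bot k).1 (Finsupp.map_mem_of_mem_supported _ (fun M' hM' => ?_) hw)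
  rw [Submodule.mem_bot, LinearMap.sub_apply, sub_eq_zero]
  exact act_mono_of_lt hb x (lt_of_le_of_lt hM' h)

theorem act_sub_lead_mem (hb : IsCharacterDatum b Λ) (i : ι ⊕ ι') (M : Multiset ι) :
    act b Λ (b i) (mono k M) - lead k i M ∈ degLE k ι M.card := by
  rw [act_mono]
  exact (actAux_spec hb _ M (Nat.lt_succ_self _) i).2

theorem act_zero (i : ι ⊕ ι') :
    act b Λ (b i) (mono k 0) = lead k i 0 + Λ (b i) • mono k 0 := by
  rw [act_mono, actAux_succ_mono, step_zero]

theorem act_of_leAll (hb : IsCharacterDatum b Λ) {i : ι ⊕ ι'} {M : Multiset ι} (h : LeAll i M) :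
    act b Λ (b i) (mono k M) = lead k i M := by
  rw [act_mono, actAux_succ_mono, step_of_leAll hb _ h]

theorem act_inl (hb : IsCharacterDatum b Λ) {i : ι} {M : Multiset ι} (h : ∀ t ∈ M, i ≤ t) :
    act b Λ (b (Sum.inl i)) (mono k M) = mono k (i ::ₘ M) :=
  act_of_leAll hb ⟨i, rfl, h⟩

theorem act_inr_zero (i : ι') :
    act b Λ (b (Sum.inr i)) (mono k 0) = Λ (b (Sum.inr i)) • mono k 0 := by
  simp [act_zero, lead]

theorem act_cons_of_not_leAll (hb : IsCharacterDatum b Λ) {i : ι ⊕ ι'} {j : ι} {T : Multiset ι}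
    (hT : ∀ t ∈ T, j ≤ t) (h : ¬ LeAll i (j ::ₘ T)) :
    act b Λ (b i) (mono k (j ::ₘ T)) = act b Λ (b (Sum.inl j)) (act b Λ (b i) (mono k T)) +
      act b Λ ⁅b i, b (Sum.inl j)⁆ (mono k T) := by
  have hlead : act b Λ (b (Sum.inl j)) (lead k i T) = lead k i (j ::ₘ T) := by
    rcases i with i | i
    · have hji : j ≤ i := by
        by_contra hlt
        refine h ⟨i, rfl, fun t ht => ?_⟩
        rcases Multiset.mem_cons.1 ht with rfl | ht
        exacts [(not_le.1 hlt).le, (not_le.1 hlt).le.trans (hT t ht)]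
      rw [lead, Sum.elim_inl, act_inl hb (by simpa using ⟨hji, hT⟩), Multiset.cons_swap]
      rfl
    · simp [lead]
  have hw := act_sub_lead_mem (k := k) hb i T
  have hlt : T.card < (j ::ₘ T).card := by simp
  rw [act_mono, actAux_succ_mono, step_cons _ hT h, act_mono_of_lt hb _ hlt,
    act_mono_of_lt hb _ hlt, act_of_lt hb _ hlt hw, map_sub, hlead]
  abel

theorem act_lie_mono_of_le (hb : IsCharacterDatum b Λ) (i : ι ⊕ ι') {l : ι} {M : Multiset ι}
    (hl : ∀ t ∈ M, l ≤ t) :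
    act b Λ ⁅b i, b (Sum.inl l)⁆ (mono k M) =
      act b Λ (b i) (act b Λ (b (Sum.inl l)) (mono k M)) -
        act b Λ (b (Sum.inl l)) (act b Λ (b i) (mono k M)) := by
  by_cases h : LeAll i (l ::ₘ M)
  · obtain ⟨i, rfl, hi⟩ := h
    have hil : i ≤ l := hi l (Multiset.mem_cons_self _ _)
    have hiM : ∀ t ∈ M, i ≤ t := fun t ht => hil.trans (hl t ht)
    rcases hil.eq_or_lt with rfl | hlt
    · simp
    · have h' : ¬ LeAll (Sum.inl l : ι ⊕ ι') (i ::ₘ M) := by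
        rintro ⟨l', hl', hle⟩
        cases hl'
        exact not_le.2 hlt (hle i (Multiset.mem_cons_self _ _))
      rw [act_inl hb hiM, act_cons_of_not_leAll hb hiM h', ← lie_skew, map_neg,
        LinearMap.neg_apply]
      abel
  · rw [act_inl hb hl, act_cons_of_not_leAll hb hl h]
    abel

theorem act_span_inr_zero {x : L}
    (hx : x ∈ Submodule.span k (Set.range fun l => b (Sum.inr l))) :
    act b Λ x (mono k 0) = Λ x • mono k 0 := by
  induction hx using Submodule.span_induction with
  | mem x hx => obtain ⟨l, rfl⟩ := hx; exact act_inr_zero l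
  | zero => simp
  | add x y _ _ hx hy => simp [hx, hy, add_smul]
  | smul c x _ hx => rw [map_smul, LinearMap.smul_apply, hx, map_smul, smul_assoc]

/-- Extension of the commutation relation from basis vectors and monomials by linearity. -/
theorem act_lie_of_mono {n : ℕ}
    (h : ∀ M : Multiset ι, M.card ≤ n → ∀ i j, act b Λ ⁅b i, b j⁆ (mono k M) =
      act b Λ (b i) (act b Λ (b j) (mono k M)) - act b Λ (b j) (act b Λ (b i) (mono k M)))
    (x y : L) {w : Multiset ι →₀ k} (hw : w ∈ degLE k ι n) :
    act b Λ ⁅x, y⁆ w = act b Λ x (act b Λ y w) - act b Λ y (act b Λ x w) := by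
  rw [← sub_eq_zero]
  refine (Submodule.mem_bot k).1 (Finsupp.map_mem_of_mem_supported
    (act b Λ ⁅x, y⁆ - (act b Λ x ∘ₗ act b Λ y - act b Λ y ∘ₗ act b Λ x)) (fun M hM => ?_) hw)
  simp only [Submodule.mem_bot, LinearMap.sub_apply, LinearMap.comp_apply, sub_eq_zero]
  induction x using b.induction_on' with
  | zero => simp
  | add x x' hx hx' => simp only [add_lie, map_add, LinearMap.add_apply, hx, hx']; abel
  | smul c x hx => simp only [smul_lie, map_smul, LinearMap.smul_apply, hx, smul_sub]
  | basis i =>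
    induction y using b.induction_on' with
    | zero => simp
    | add x x' hx hx' => simp only [lie_add, map_add, LinearMap.add_apply, hx, hx']; abel
    | smul c x hx => simp only [lie_smul, map_smul, LinearMap.smul_apply, hx, smul_sub]
    | basis j => exact h M hM i j

/-- The action is a representation. If neither `i` nor `j` can be put in front of `z_T`, split off the
least variable `z_l` of `T`: the Jacobi identity for `b i`, `b j`, `b l` reduces the relation to the
case in which one of the two elements is `b l`. -/
theorem act_lie_mono (hb : IsCharacterDatum b Λ) (n : ℕ) : ∀ T : Multiset ι, T.card ≤ n → ∀ i j,
    act b Λ ⁅b i, b j⁆ (mono k T) =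
      act b Λ (b i) (act b Λ (b j) (mono k T)) - act b Λ (b j) (act b Λ (b i) (mono k T)) := by
  induction n with
  | zero =>
    intro T hT i j
    obtain rfl : T = 0 := by simpa using hT
    rcases j with j | j
    · exact act_lie_mono_of_le hb i (by simp)
    rcases i with i | i
    · rw [← lie_skew, map_neg, LinearMap.neg_apply, act_lie_mono_of_le hb _ (by simp)]
      abel
    · rw [act_span_inr_zero (hb.lie_mem i j), hb.map_lie, act_inr_zero, act_inr_zero, map_smul,
        map_smul, act_inr_zero, act_inr_zero, smul_comm, zero_smul, sub_self]
  | succ n ih =>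
    intro T hT i j
    by_cases hj : LeAll j T
    · obtain ⟨j, rfl, hj⟩ := hj
      exact act_lie_mono_of_le hb i hj
    by_cases hi : LeAll i T
    · obtain ⟨i, rfl, hi⟩ := hi
      rw [← lie_skew, map_neg, LinearMap.neg_apply, act_lie_mono_of_le hb _ hi]
      abel
    by_cases h0 : T = 0
    · subst h0
      exact ih 0 (by simp) i j
    obtain ⟨⟨l, T⟩, rfl, hl⟩ := Multiset.exists_eq_cons_le h0
    have hcard : T.card ≤ n := by simpa using hT
    have ihl := fun x y => act_lie_of_mono ih x y (mono_mem_degLE hcard)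
    -- the relation for `b i` and `b l` also holds on `b j • z_T`, whose top term is `z_{j, T}`
    have hG : ∀ i j : ι ⊕ ι', ¬ LeAll j (l ::ₘ T) →
        act b Λ ⁅b i, b (Sum.inl l)⁆ (act b Λ (b j) (mono k T)) =
          act b Λ (b i) (act b Λ (b (Sum.inl l)) (act b Λ (b j) (mono k T))) -
            act b Λ (b (Sum.inl l)) (act b Λ (b i) (act b Λ (b j) (mono k T))) := by
      intro i j hj
      have h1 := act_lie_of_mono ih (b i) (b (Sum.inl l))
        (degLE_mono hcard (act_sub_lead_mem hb j T))
      have h2 : act b Λ ⁅b i, b (Sum.inl l)⁆ (lead k j T) =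
          act b Λ (b i) (act b Λ (b (Sum.inl l)) (lead k j T)) -
            act b Λ (b (Sum.inl l)) (act b Λ (b i) (lead k j T)) := by
        rcases j with j | j
        · have hlj : l ≤ j := by
            by_contra hlt
            refine hj ⟨j, rfl, fun t ht => ?_⟩
            rcases Multiset.mem_cons.1 ht with rfl | ht
            exacts [(not_le.1 hlt).le, (not_le.1 hlt).le.trans (hl t ht)]
          exact act_lie_mono_of_le hb i (by simpa using ⟨hlj, hl⟩)
        · simp [lead]
      simp only [map_sub] at h1
      rw [sub_eq_iff_eq_add.1 h1, h2]
      abel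
    have hz : mono k (l ::ₘ T) = act b Λ (b (Sum.inl l)) (mono k T) := (act_inl hb hl).symm
    have e1 := ihl (b j) (b (Sum.inl l))
    have e2 := ihl (b i) (b (Sum.inl l))
    have e3 := ihl (b i) ⁅b j, b (Sum.inl l)⁆
    have e4 := ihl (b j) ⁅b i, b (Sum.inl l)⁆
    have e5 := ihl ⁅b i, b j⁆ (b (Sum.inl l))
    have e6 := ihl (b i) (b j)
    rw [lie_lie, map_sub, LinearMap.sub_apply, e3, e4, e6] at e5
    have e7 := hG i j hj
    have e8 := hG j i hi
    rw [e1, e2] at e5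
    simp only [map_sub] at e5
    rw [hz]
    rw [e7, e8] at e5
    rw [← sub_eq_zero] at e5 ⊢
    rw [← neg_eq_zero, ← e5]
    abel

variable (b Λ) in
/-- The representation of the Lie algebra on the span of the monomials, which is the module
induced from the character `Λ` of the subalgebra. -/
noncomputable def rep (hb : IsCharacterDatum b Λ) : L →ₗ⁅k⁆ Module.End k (Multiset ι →₀ k) where
  __ := act b Λ
  map_lie' {x y} := by
    refine Finsupp.lhom_ext' fun M => LinearMap.ext_ring ?_
    exact act_lie_of_mono (act_lie_mono hb M.card) x y (mono_mem_degLE le_rfl)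

section UniversalProperty

variable {V : Type*} [AddCommGroup V] [Module k V] (σ : L →ₗ⁅k⁆ Module.End k V) (v : V)

variable (b) in
/-- The linear map that sends `z_M` to the ordered product of the basis vectors in `M`, applied to
`v`. -/
noncomputable def fromMono : (Multiset ι →₀ k) →ₗ[k] V :=
  Finsupp.linearCombination k fun M : Multiset ι =>
    (M.sort (· ≤ ·)).foldr (fun i w => σ (b (Sum.inl i)) w) v

theorem fromMono_zero : fromMono b σ v (mono k 0) = v := by
  simp [fromMono]

theorem fromMono_cons {j : ι} {T : Multiset ι} (h : ∀ t ∈ T, j ≤ t) :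
    fromMono b σ v (mono k (j ::ₘ T)) = σ (b (Sum.inl j)) (fromMono b σ v (mono k T)) := by
  simp only [fromMono, Finsupp.linearCombination_single, one_smul]
  rw [Multiset.sort_cons _ _ _ h, List.foldr_cons]

/-- The universal property of the induced module: `fromMono` is a homomorphism if the subalgebra
acts on `v` through `Λ`. -/
theorem fromMono_rep (hb : IsCharacterDatum b Λ)
    (hv : ∀ i, σ (b (Sum.inr i)) v = Λ (b (Sum.inr i)) • v) (x : L) (p : Multiset ι →₀ k) :
    fromMono b σ v (rep b Λ hb x p) = σ x (fromMono b σ v p) := by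
  have key : ∀ n : ℕ, ∀ x : L, ∀ w ∈ degLE k ι n,
      fromMono b σ v (act b Λ x w) = σ x (fromMono b σ v w) := by
    have lin : ∀ n : ℕ, (∀ M : Multiset ι, M.card ≤ n → ∀ i,
        fromMono b σ v (act b Λ (b i) (mono k M)) = σ (b i) (fromMono b σ v (mono k M))) →
        ∀ x : L, ∀ w ∈ degLE k ι n,
          fromMono b σ v (act b Λ x w) = σ x (fromMono b σ v w) := by
      intro n h x w hw
      rw [← sub_eq_zero]
      refine (Submodule.mem_bot k).1 (Finsupp.map_mem_of_mem_supported
        (fromMono b σ v ∘ₗ act b Λ x - σ x ∘ₗ fromMono b σ v) (fun M hM => ?_) hw)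
      rw [Submodule.mem_bot, LinearMap.sub_apply, sub_eq_zero]
      exact apply_eq_of_basis (b := b)
        (f := fromMono b σ v ∘ₗ (act b Λ).flip (mono k M))
        (g := (σ : L →ₗ[k] Module.End k V).flip (fromMono b σ v (mono k M))) (h M hM) x
    have hle : ∀ (M : Multiset ι) (i : ι ⊕ ι'), LeAll i M →
        fromMono b σ v (act b Λ (b i) (mono k M)) = σ (b i) (fromMono b σ v (mono k M)) := by
      rintro M _ ⟨i, rfl, hi⟩
      rw [act_inl hb hi, fromMono_cons σ v hi]
    intro n
    induction n with
    | zero =>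
      refine lin 0 fun M hM i => ?_
      obtain rfl : M = 0 := by simpa using hM
      rcases i with i | i
      · exact hle 0 _ ⟨i, rfl, by simp⟩
      · rw [act_inr_zero, map_smul, fromMono_zero, hv]
    | succ n ih =>
      refine lin _ fun M hM i => ?_
      by_cases hi : LeAll i M
      · exact hle M i hi
      by_cases h0 : M = 0
      · subst h0
        exact ih _ _ (mono_mem_degLE (by simp))
      obtain ⟨⟨j, T⟩, rfl, hT⟩ := Multiset.exists_eq_cons_le h0
      have hcard : T.card ≤ n := by simpa using hM
      have hTm := mono_mem_degLE (k := k) hcard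
      have h1 : fromMono b σ v (act b Λ (b (Sum.inl j)) (act b Λ (b i) (mono k T))) =
          σ (b (Sum.inl j)) (fromMono b σ v (act b Λ (b i) (mono k T))) := by
        have hw := ih (b (Sum.inl j)) _ (degLE_mono hcard (act_sub_lead_mem hb i T))
        have hl : fromMono b σ v (act b Λ (b (Sum.inl j)) (lead k i T)) =
            σ (b (Sum.inl j)) (fromMono b σ v (lead k i T)) := by
          rcases i with i | i
          · have hji : j ≤ i := by
              by_contra hlt
              refine hi ⟨i, rfl, fun t ht => ?_⟩
              rcases Multiset.mem_cons.1 ht with rfl | ht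
              exacts [(not_le.1 hlt).le, (not_le.1 hlt).le.trans (hT t ht)]
            exact hle _ _ ⟨j, rfl, by simpa using ⟨hji, hT⟩⟩
          · simp [lead]
        simp only [map_sub] at hw
        rw [sub_eq_iff_eq_add.1 hw, hl]
        abel
      rw [act_cons_of_not_leAll hb hT hi, map_add, h1, ih _ _ hTm, ih _ _ hTm,
        fromMono_cons σ v hT, LieHom.map_lie, Ring.lie_def, LinearMap.sub_apply,
        Module.End.mul_apply, Module.End.mul_apply]
      abel
  refine LinearMap.congr_fun (f := fromMono b σ v ∘ₗ act b Λ x) (g := σ x ∘ₗ fromMono b σ v) ?_ p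
  exact Finsupp.lhom_ext' fun M => LinearMap.ext_ring
    (key M.card x _ (mono_mem_degLE le_rfl))

end UniversalProperty

end InducedModule

/-! ### The Verma module as a module of monomials -/

namespace UniversalEnvelopingAlgebra

variable {k L : Type*} [Field k] [LieRing L] [LieAlgebra k L]

attribute [local instance] LieRing.ofAssociativeRing

theorem induction_on {p : UniversalEnvelopingAlgebra k L → Prop}
    (u : UniversalEnvelopingAlgebra k L)
    (algebraMap : ∀ c, p (algebraMap k _ c)) (ι : ∀ x, p (ι k x))
    (add : ∀ u v, p u → p v → p (u + v)) (mul : ∀ u v, p u → p v → p (u * v)) : p u := by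
  let S : Subalgebra k (UniversalEnvelopingAlgebra k L) :=
    { carrier := {u | p u}
      mul_mem' := fun ha hb => mul _ _ ha hb
      add_mem' := fun ha hb => add _ _ ha hb
      algebraMap_mem' := algebraMap }
  let f : L →ₗ⁅k⁆ S :=
    { toFun := fun x => ⟨UniversalEnvelopingAlgebra.ι k x, ι x⟩
      map_add' := fun x y => Subtype.ext (map_add _ x y)
      map_smul' := fun c x => Subtype.ext (map_smul _ c x)
      map_lie' := fun {x y} => Subtype.ext (LieHom.map_lie _ x y) }
  have h : S.val.comp (lift k f) = AlgHom.id k _ := by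
    ext x
    simp [f]
  have hu : (lift k f u : UniversalEnvelopingAlgebra k L) = u := DFunLike.congr_fun h u
  rw [← hu]
  exact (lift k f u).2

end UniversalEnvelopingAlgebra

namespace InducedModule

attribute [local instance] LieRing.ofAssociativeRing

variable {k L ι ι' : Type*} [Field k] [LieRing L] [LieAlgebra k L] [LinearOrder ι]
  {b : Module.Basis (ι ⊕ ι') k L} {Λ : L →ₗ[k] k}

theorem rep_inl (hb : IsCharacterDatum b Λ) {i : ι} {M : Multiset ι} (h : ∀ t ∈ M, i ≤ t) :
    rep b Λ hb (b (Sum.inl i)) (mono k M) = mono k (i ::ₘ M) :=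
  act_inl hb h

theorem rep_zero (hb : IsCharacterDatum b Λ) {x : L}
    (hx : x ∈ Submodule.span k (Set.range fun l => b (Sum.inr l))) :
    rep b Λ hb x (mono k 0) = Λ x • mono k 0 :=
  act_span_inr_zero hx

theorem rep_lie_apply (hb : IsCharacterDatum b Λ) (x y : L) (p : Multiset ι →₀ k) :
    rep b Λ hb x (rep b Λ hb y p) = rep b Λ hb y (rep b Λ hb x p) + rep b Λ hb ⁅x, y⁆ p := by
  rw [LieHom.map_lie, Ring.lie_def, LinearMap.sub_apply, Module.End.mul_apply,
    Module.End.mul_apply]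
  abel

variable (b Λ) in
/-- The action of the enveloping algebra on the module of monomials. -/
noncomputable def envRep (hb : IsCharacterDatum b Λ) :
    UniversalEnvelopingAlgebra k L →ₐ[k] Module.End k (Multiset ι →₀ k) :=
  UniversalEnvelopingAlgebra.lift k (rep b Λ hb)

theorem envRep_ι (hb : IsCharacterDatum b Λ) (x : L) :
    envRep b Λ hb (UniversalEnvelopingAlgebra.ι k x) = rep b Λ hb x :=
  UniversalEnvelopingAlgebra.lift_ι_apply k _ x

/-- A homomorphism of representations of the Lie algebra commutes with the enveloping algebra. -/
theorem map_envRep (hb : IsCharacterDatum b Λ) {V : Type*} [AddCommGroup V] [Module k V]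
    (τ : UniversalEnvelopingAlgebra k L →ₐ[k] Module.End k V) (f : (Multiset ι →₀ k) →ₗ[k] V)
    (hf : ∀ x p, f (rep b Λ hb x p) = τ (UniversalEnvelopingAlgebra.ι k x) (f p))
    (u : UniversalEnvelopingAlgebra k L) (p : Multiset ι →₀ k) :
    f (envRep b Λ hb u p) = τ u (f p) := by
  induction u using UniversalEnvelopingAlgebra.induction_on generalizing p with
  | algebraMap c => simp [AlgHom.commutes, Module.algebraMap_end_apply]
  | ι x => rw [envRep_ι, hf]
  | add u v hu hv => simp [hu, hv]
  | mul u v hu hv => simp [hu, hv]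

/-- The monomial `1` generates the module of monomials. -/
theorem exists_envRep_mono_zero (hb : IsCharacterDatum b Λ) (p : Multiset ι →₀ k) :
    ∃ u, envRep b Λ hb u (mono k 0) = p := by
  let R : Submodule k (Multiset ι →₀ k) :=
    LinearMap.range ((envRep b Λ hb).toLinearMap.flip (mono k 0))
  have hR : ∀ M : Multiset ι, mono k M ∈ R := by
    intro M
    induction hn : M.card using Nat.strong_induction_on generalizing M with
    | _ n ih =>
      by_cases h0 : M = 0
      · subst h0
        exact ⟨1, by simp⟩
      obtain ⟨⟨j, T⟩, rfl, hT⟩ := Multiset.exists_eq_cons_le h0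
      obtain ⟨u, hu⟩ := ih T.card (by simp [← hn]) T rfl
      refine ⟨UniversalEnvelopingAlgebra.ι k (b (Sum.inl j)) * u, ?_⟩
      simp only [LinearMap.flip_apply, AlgHom.toLinearMap_apply] at hu ⊢
      rw [map_mul, Module.End.mul_apply, hu, envRep_ι, rep_inl hb hT]
  have : p ∈ R := by
    induction p using Finsupp.induction_linear with
    | zero => exact zero_mem _
    | add f g hf hg => exact add_mem hf hg
    | single M c =>
      have := R.smul_mem c (hR M)
      rwa [Finsupp.smul_single, smul_eq_mul, mul_one] at this
  obtain ⟨u, hu⟩ := this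
  exact ⟨u, hu⟩

variable {h n : Submodule k L} {l : Module.Dual k h}

/-- Every Verma module whose defining subalgebra is spanned by the basis vectors with index in `ι'`
has the monomials as a basis. -/
theorem exists_vermaEquiv (hb : IsCharacterDatum b Λ)
    (hn : ∀ x ∈ n, x ∈ Submodule.span k (Set.range fun l => b (Sum.inr l)) ∧ Λ x = 0)
    (hh : ∀ x : h, (x : L) ∈ Submodule.span k (Set.range fun l => b (Sum.inr l)) ∧ Λ x = l x)
    (hb' : ∀ i, b (Sum.inr i) ∈ n ∨ b (Sum.inr i) ∈ h) :
    ∃ e : VermaModule h n l ≃ₗ[k] (Multiset ι →₀ k),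
      ∀ u m, e (u • m) = envRep b Λ hb u (e m) := by
  let J := vermaIdeal h n l
  let τ : UniversalEnvelopingAlgebra k L →ₐ[k] Module.End k (VermaModule h n l) :=
    Algebra.lsmul k k _
  let σ : L →ₗ⁅k⁆ Module.End k (VermaModule h n l) := (UniversalEnvelopingAlgebra.lift k).symm τ
  let v₀ : VermaModule h n l := J.mkQ 1
  have hv₀ : ∀ i, σ (b (Sum.inr i)) v₀ = Λ (b (Sum.inr i)) • v₀ := by
    intro i
    change UniversalEnvelopingAlgebra.ι k (b (Sum.inr i)) • v₀ = _
    rw [← algebraMap_smul (UniversalEnvelopingAlgebra k L) (Λ (b (Sum.inr i))) v₀,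
      ← sub_eq_zero, ← sub_smul, ← map_smul, Submodule.mkQ_apply,
      Submodule.Quotient.mk_eq_zero, smul_eq_mul, mul_one]
    apply Submodule.subset_span
    rcases hb' i with hi | hi
    · left
      exact ⟨_, hi, by rw [(hn _ hi).2, map_zero, sub_zero]⟩
    · right
      exact ⟨⟨_, hi⟩, by rw [(hh ⟨_, hi⟩).2]⟩
  let q : (Multiset ι →₀ k) →ₗ[k] VermaModule h n l := fromMono b σ v₀
  have hq : ∀ u p, q (envRep b Λ hb u p) = u • q p :=
    map_envRep hb τ q (fromMono_rep _ _ hb hv₀)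
  have hq0 : q (mono k 0) = v₀ := fromMono_zero _ _
  -- the defining relations of the Verma module hold for the monomial `1`
  have hJ : ∀ u ∈ J, envRep b Λ hb u (mono k 0) = 0 := by
    intro u hu
    induction hu using Submodule.span_induction with
    | mem u hu =>
      rcases hu with ⟨x, hx, rfl⟩ | ⟨x, rfl⟩
      · rw [envRep_ι, rep_zero hb (hn x hx).1, (hn x hx).2, zero_smul]
      · rw [map_sub, LinearMap.sub_apply, envRep_ι, rep_zero hb (hh x).1, (hh x).2,
          AlgHom.commutes, Module.algebraMap_end_apply, sub_self]
    | zero => simp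
    | add u v _ _ hu hv => simp [hu, hv]
    | smul a u _ hu => simp [hu]
  have hbij : Function.Bijective q := by
    constructor
    · rw [injective_iff_map_eq_zero]
      intro p hp
      obtain ⟨u, rfl⟩ := exists_envRep_mono_zero hb p
      rw [hq, hq0] at hp
      apply hJ
      rw [← Submodule.Quotient.mk_eq_zero, ← hp]
      change J.mkQ u = u • J.mkQ 1
      rw [← map_smul, smul_eq_mul, mul_one]
    · intro m
      obtain ⟨u, rfl⟩ := J.mkQ_surjective m
      refine ⟨envRep b Λ hb u (mono k 0), ?_⟩
      rw [hq, hq0]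
      change u • J.mkQ 1 = J.mkQ u
      rw [← map_smul, smul_eq_mul, mul_one]
  refine ⟨(LinearEquiv.ofBijective q hbij).symm, fun u m => ?_⟩
  rw [LinearEquiv.symm_apply_eq]
  change _ = q _
  rw [hq]
  congr 1
  exact ((LinearEquiv.ofBijective q hbij).apply_symm_apply m).symm

end InducedModule

/-! ### The degree filtration and its Heisenberg symbol -/

theorem Module.Basis.map_mem_of_repr {k V W α : Type*} [Field k] [AddCommGroup V] [Module k V]
    [AddCommGroup W] [Module k W] (b : Module.Basis α k V) (f : V →ₗ[k] W) {Q : Submodule k W}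
    {x : V} (h : ∀ l, b.repr x l ≠ 0 → f (b l) ∈ Q) : f x ∈ Q := by
  rw [← b.linearCombination_repr x, Finsupp.linearCombination_apply, Finsupp.sum, map_sum]
  refine sum_mem fun l hl => ?_
  rw [map_smul]
  exact Q.smul_mem _ (h l (Finsupp.mem_support_iff.1 hl))

namespace InducedModule

attribute [local instance] LieRing.ofAssociativeRing

section

variable {ι ι' : Type*} (deg : ι ⊕ ι' → ℤ)

/-- The degree of the monomial `z_M`. -/
def degM (M : Multiset ι) : ℤ := (M.map fun i => deg (Sum.inl i)).sum

@[simp] theorem degM_zero : degM deg 0 = 0 := rfl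

@[simp] theorem degM_cons (j : ι) (M : Multiset ι) :
    degM deg (j ::ₘ M) = deg (Sum.inl j) + degM deg M := by
  simp [degM]

theorem degM_erase [DecidableEq ι] {j : ι} {M : Multiset ι} (h : j ∈ M) :
    degM deg (M.erase j) = degM deg M - deg (Sum.inl j) := by
  conv_rhs => rw [← Multiset.cons_erase h, degM_cons]
  ring

/-- The span of the monomials of degree at least `c`. -/
noncomputable def fil (k : Type*) [Field k] (c : ℤ) : Submodule k (Multiset ι →₀ k) :=
  Finsupp.supported k k {M | c ≤ degM deg M}

variable {deg} in
theorem fil_anti {k : Type*} [Field k] {c d : ℤ} (h : d ≤ c) : fil deg k c ≤ fil deg k d :=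
  Finsupp.supported_mono fun _ hM => le_trans h hM

variable {deg} in
theorem mono_mem_fil {k : Type*} [Field k] {M : Multiset ι} {c : ℤ} (h : c ≤ degM deg M) :
    mono k M ∈ fil deg k c :=
  Finsupp.single_mem_supported k _ h

end

variable {k L ι ι' : Type*} [Field k] [LieRing L] [LieAlgebra k L] [LinearOrder ι]
  {b : Module.Basis (ι ⊕ ι') k L} {Λ : L →ₗ[k] k} {deg : ι ⊕ ι' → ℤ}

variable (b Λ deg) in
/-- A degree on the basis vectors for which the associated graded Lie algebra is a Heisenberg
algebra: the bracket with a basis vector of the complement raises the degree, strictly so except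
for contributions from basis vectors that only act through `Λ` on the associated graded module. -/
structure IsHeisenbergDegree : Prop where
  map_inl_lie_inl : ∀ i j, Λ ⁅b (Sum.inl i), b (Sum.inl j)⁆ = 0
  deg_le_of_map : ∀ i, Λ (b i) ≠ 0 → deg i ≤ 0
  deg_le_of_map_lie : ∀ i j, Λ ⁅b i, b (Sum.inl j)⁆ ≠ 0 → deg i + deg (Sum.inl j) ≤ 0
  deg_lie : ∀ i j l, b.repr ⁅b i, b (Sum.inl j)⁆ l ≠ 0 →
    deg i + deg (Sum.inl j) < deg l ∨ deg i + deg (Sum.inl j) ≤ deg l ∧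
      ∃ l', l = Sum.inr l' ∧ ∀ j, Λ ⁅b l, b (Sum.inl j)⁆ = 0

variable (b Λ) in
/-- The symbol of the action of `b i` on the monomial `z_M`: multiplication by a variable for a
basis vector of the complement; for a basis vector of the subalgebra, the scalar `Λ (b i)` plus the
derivation that sends the variable `z_j` to `Λ ⁅b i, b j⁆`. -/
noncomputable def symbolMono (i : ι ⊕ ι') (M : Multiset ι) : Multiset ι →₀ k :=
  i.elim (fun i => mono k (i ::ₘ M)) fun i => Λ (b (Sum.inr i)) • mono k M +
    (M.map fun j => Λ ⁅b (Sum.inr i), b (Sum.inl j)⁆ • mono k (M.erase j)).sum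

variable (b Λ) in
/-- The symbol of the action of `b i`, as a linear map. -/
noncomputable def symbol (i : ι ⊕ ι') : (Multiset ι →₀ k) →ₗ[k] (Multiset ι →₀ k) :=
  Finsupp.linearCombination k (symbolMono b Λ i)

theorem symbol_mono (i : ι ⊕ ι') (M : Multiset ι) :
    symbol b Λ i (mono k M) = symbolMono b Λ i M := by
  rw [symbol, Finsupp.linearCombination_single, one_smul]

theorem symbol_inl_mono (i : ι) (M : Multiset ι) :
    symbol b Λ (Sum.inl i) (mono k M) = mono k (i ::ₘ M) :=
  symbol_mono _ _

theorem symbolMono_mem_degLE (i : ι ⊕ ι') (M : Multiset ι) :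
    symbolMono b Λ i M - lead k i M ∈ degLE k ι M.card := by
  rcases i with i | i
  · simp [symbolMono, lead]
  · simp only [symbolMono, lead, Sum.elim_inr, sub_zero]
    refine add_mem (Submodule.smul_mem _ _ (mono_mem_degLE le_rfl)) (multiset_sum_mem _ ?_)
    intro p hp
    obtain ⟨j, hj, rfl⟩ := Multiset.mem_map.1 hp
    exact Submodule.smul_mem _ _ (mono_mem_degLE (Multiset.card_le_card (Multiset.erase_le _ _)))

theorem symbolMono_mem_fil (hd : IsHeisenbergDegree b Λ deg) (i : ι ⊕ ι') (M : Multiset ι) :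
    symbolMono b Λ i M ∈ fil deg k (degM deg M + deg i) := by
  rcases i with i | i
  · exact mono_mem_fil (by rw [degM_cons, add_comm])
  · simp only [symbolMono, Sum.elim_inr]
    refine add_mem ?_ (multiset_sum_mem _ ?_)
    · by_cases h : Λ (b (Sum.inr i)) = 0
      · simp [h]
      · exact Submodule.smul_mem _ _ (mono_mem_fil (by linarith [hd.deg_le_of_map _ h]))
    · intro p hp
      obtain ⟨j, hj, rfl⟩ := Multiset.mem_map.1 hp
      by_cases h : Λ ⁅b (Sum.inr i), b (Sum.inl j)⁆ = 0
      · simp [h]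
      · refine Submodule.smul_mem _ _ (mono_mem_fil ?_)
        rw [degM_erase deg hj]
        linarith [hd.deg_le_of_map_lie _ _ h]

theorem symbolMono_cons (hd : IsHeisenbergDegree b Λ deg) (i : ι ⊕ ι') (j : ι) (T : Multiset ι) :
    symbolMono b Λ i (j ::ₘ T) = symbol b Λ (Sum.inl j) (symbolMono b Λ i T) +
      Λ ⁅b i, b (Sum.inl j)⁆ • mono k T := by
  rcases i with i | i
  · simp only [symbolMono, Sum.elim_inl, symbol_inl_mono, hd.map_inl_lie_inl, zero_smul, add_zero]
    rw [Multiset.cons_swap]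
  · simp only [symbolMono, Sum.elim_inr, Multiset.map_cons, Multiset.sum_cons, map_add, map_smul,
      symbol_inl_mono, Multiset.erase_cons_head, map_multiset_sum, Multiset.map_map,
      Function.comp_def]
    have : T.map (fun l => Λ ⁅b (Sum.inr i), b (Sum.inl l)⁆ • mono k ((j ::ₘ T).erase l)) =
        T.map (fun l => Λ ⁅b (Sum.inr i), b (Sum.inl l)⁆ • mono k (j ::ₘ T.erase l)) := by
      refine Multiset.map_congr rfl fun l hl => ?_
      rw [Multiset.erase_cons_tail_of_mem hl]
    rw [this]
    abel

/-- The action of `b i` agrees with its symbol up to terms of strictly higher degree. -/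
theorem rep_sub_symbolMono_mem (hb : IsCharacterDatum b Λ) (hd : IsHeisenbergDegree b Λ deg)
    (n : ℕ) : ∀ T : Multiset ι, T.card ≤ n → ∀ i,
    rep b Λ hb (b i) (mono k T) - symbolMono b Λ i T ∈ fil deg k (degM deg T + deg i + 1) := by
  have hLe : ∀ (i : ι ⊕ ι') (T : Multiset ι), LeAll i T →
      rep b Λ hb (b i) (mono k T) - symbolMono b Λ i T ∈ fil deg k (degM deg T + deg i + 1) := by
    rintro _ T ⟨i, rfl, h⟩
    simp [rep_inl hb h, symbolMono]
  induction n with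
  | zero =>
    intro T hT i
    obtain rfl : T = 0 := by simpa using hT
    rcases i with i | i
    · exact hLe _ _ ⟨i, rfl, by simp⟩
    · simp [rep_zero hb (Submodule.subset_span ⟨i, rfl⟩), symbolMono]
  | succ n ih =>
    intro T hT i
    by_cases hi : LeAll i T
    · exact hLe _ _ hi
    by_cases h0 : T = 0
    · subst h0
      exact ih 0 (by simp) i
    obtain ⟨⟨j, T⟩, rfl, hj⟩ := Multiset.exists_eq_cons_le h0
    have hcard : T.card ≤ n := by simpa using hT
    set c := degM deg T with hc
    -- the inductive hypothesis on linear combinations of monomials of degree at most `|T|`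
    have ihw : ∀ i : ι ⊕ ι', ∀ d : ℤ, ∀ w ∈ fil deg k d, w ∈ degLE k ι T.card →
        rep b Λ hb (b i) w - symbol b Λ i w ∈ fil deg k (d + deg i + 1) ∧
          rep b Λ hb (b i) w ∈ fil deg k (d + deg i) := by
      intro i d w hw hw'
      have hw2 : w ∈ Finsupp.supported k k ({M | d ≤ degM deg M} ∩ {M | M.card ≤ T.card}) := by
        rw [Finsupp.supported_inter]
        exact ⟨hw, hw'⟩
      have h1 : rep b Λ hb (b i) w - symbol b Λ i w ∈ fil deg k (d + deg i + 1) := by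
        refine Finsupp.map_mem_of_mem_supported (rep b Λ hb (b i) - symbol b Λ i) ?_ hw2
        rintro M ⟨hM1, hM2⟩
        rw [LinearMap.sub_apply, symbol_mono]
        exact fil_anti (by simpa using hM1) (ih M (le_trans hM2 hcard) i)
      refine ⟨h1, ?_⟩
      have h2 : symbol b Λ i w ∈ fil deg k (d + deg i) := by
        refine Finsupp.map_mem_of_mem_supported (symbol b Λ i) ?_ hw2
        rintro M ⟨hM1, hM2⟩
        rw [symbol_mono]
        exact fil_anti (by simpa using hM1) (symbolMono_mem_fil hd i M)
      have := add_mem (fil_anti (by linarith) h1) h2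
      rwa [sub_add_cancel] at this
    have hlie : rep b Λ hb ⁅b i, b (Sum.inl j)⁆ (mono k T) - Λ ⁅b i, b (Sum.inl j)⁆ • mono k T ∈
        fil deg k (c + deg i + deg (Sum.inl j) + 1) := by
      refine b.map_mem_of_repr ((rep b Λ hb : L →ₗ[k] Module.End k (Multiset ι →₀ k)).flip
        (mono k T) - Λ.smulRight (mono k T)) fun l hl => ?_
      change rep b Λ hb (b l) (mono k T) - Λ (b l) • mono k T ∈ _
      have h1 := ih T hcard l
      rcases hd.deg_lie i j l hl with h | ⟨h, l, rfl, hl'⟩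
      · have h2 := symbolMono_mem_fil (k := k) hd l T
        have h3 : Λ (b l) • mono k T ∈ fil deg k (c + deg i + deg (Sum.inl j) + 1) := by
          by_cases h0 : Λ (b l) = 0
          · simp [h0]
          · refine Submodule.smul_mem _ _ (mono_mem_fil ?_)
            linarith [hd.deg_le_of_map l h0]
        have h4 := add_mem (fil_anti (by linarith) h1) h2
        rw [sub_add_cancel] at h4
        exact sub_mem (fil_anti (by linarith) h4) h3
      · have h2 : symbolMono b Λ (Sum.inr l) T = Λ (b (Sum.inr l)) • mono k T := by
          simp [symbolMono, hl']
        rw [h2] at h1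
        exact fil_anti (by linarith) h1
    have hw := ih T hcard i
    have hw' : rep b Λ hb (b i) (mono k T) - symbolMono b Λ i T ∈ degLE k ι T.card := by
      have := sub_mem (act_sub_lead_mem hb i T) (symbolMono_mem_degLE (b := b) (Λ := Λ) i T)
      rwa [sub_sub_sub_cancel_right] at this
    have h1 := (ihw (Sum.inl j) _ _ hw hw').2
    have h2 : rep b Λ hb (b (Sum.inl j)) (symbolMono b Λ i T) -
        symbol b Λ (Sum.inl j) (symbolMono b Λ i T) ∈
          fil deg k (c + deg i + deg (Sum.inl j) + 1) := by
      rcases i with i | i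
      · have hji : j ≤ i := by
          by_contra hlt
          refine hi ⟨i, rfl, fun t ht => ?_⟩
          rcases Multiset.mem_cons.1 ht with rfl | ht
          exacts [(not_le.1 hlt).le, (not_le.1 hlt).le.trans (hj t ht)]
        have : ∀ t ∈ i ::ₘ T, j ≤ t := by simpa using ⟨hji, hj⟩
        simp only [symbolMono, Sum.elim_inl]
        rw [rep_inl hb this, symbol_inl_mono, sub_self]
        exact zero_mem _
      · have h3 := symbolMono_mem_degLE (b := b) (Λ := Λ) (Sum.inr i) T
        simp only [lead, Sum.elim_inr, sub_zero] at h3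
        exact (ihw (Sum.inl j) _ _ (symbolMono_mem_fil hd _ T) h3).1
    have h3 := add_mem (add_mem (fil_anti (by linarith) h1) h2) hlie
    have h4 : rep b Λ hb (b i) (mono k (j ::ₘ T)) =
        rep b Λ hb (b (Sum.inl j)) (rep b Λ hb (b i) (mono k T)) +
          rep b Λ hb ⁅b i, b (Sum.inl j)⁆ (mono k T) := by
      rw [← rep_lie_apply, rep_inl hb hj]
    rw [h4, symbolMono_cons hd]
    rw [map_sub] at h3
    convert h3 using 1
    · rw [degM_cons]
      congr 1
      ring
    · abel

theorem rep_mem_fil (hb : IsCharacterDatum b Λ) (hd : IsHeisenbergDegree b Λ deg) (i : ι ⊕ ι')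
    {c : ℤ} {w : Multiset ι →₀ k} (hw : w ∈ fil deg k c) :
    rep b Λ hb (b i) w ∈ fil deg k (c + deg i) := by
  refine Finsupp.map_mem_of_mem_supported _ (fun M hM => ?_) hw
  have h := add_mem (fil_anti (by linarith) (rep_sub_symbolMono_mem hb hd _ M le_rfl i))
    (symbolMono_mem_fil hd i M)
  rw [sub_add_cancel] at h
  exact fil_anti (by simpa using hM) h

/-! ### Triangularity of the pairing with monomials -/

variable (b Λ deg) in
/-- Basis vectors of the subalgebra indexed by `ι` and dual, for the pairing `Λ ⁅·, ·⁆`, to those of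
the complement, up to terms that involve variables of smaller degree. -/
structure IsDualFamily (star : ι → ι') : Prop where
  deg_star : ∀ j, deg (Sum.inr (star j)) = -deg (Sum.inl j)
  map_star : ∀ j, Λ (b (Sum.inr (star j))) = 0
  map_lie_star : ∀ j l, l ≠ j → Λ ⁅b (Sum.inr (star j)), b (Sum.inl l)⁆ ≠ 0 →
    deg (Sum.inl l) < deg (Sum.inl j)

variable {star : ι → ι'} {ψ : Multiset ι → Module.Dual k (Multiset ι →₀ k)}

/-- Functionals `ψ_T` obtained from the constant coefficient by composition with the basis vectors
dual to the elements of `T`: `ψ_T` kills all monomials of degree larger than that of `T`. -/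
theorem pairing_eq_zero_of_lt (hb : IsCharacterDatum b Λ) (hd : IsHeisenbergDegree b Λ deg)
    (hs : IsDualFamily b Λ deg star) (hψ0 : ψ 0 = Finsupp.lapply 0)
    (hψ : ∀ j T, (∀ t ∈ T, j ≤ t) → ∀ p, ψ (j ::ₘ T) p =
      ψ T (rep b Λ hb (b (Sum.inr (star j))) p))
    (T : Multiset ι) {w : Multiset ι →₀ k} (hw : w ∈ fil deg k (degM deg T + 1)) : ψ T w = 0 := by
  induction hn : T.card generalizing T w with
  | zero =>
    obtain rfl : T = 0 := by simpa using hn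
    rw [hψ0, Finsupp.lapply_apply]
    by_contra h
    have : (0 : Multiset ι) ∈ {M | degM deg 0 + 1 ≤ degM deg M} :=
      hw (Finsupp.mem_support_iff.2 h)
    simp at this
  | succ n ih =>
    obtain ⟨⟨j, T⟩, rfl, hj⟩ := Multiset.exists_eq_cons_le (M := T) (by rintro rfl; simp at hn)
    rw [hψ j T hj]
    refine ih T (fil_anti ?_ (rep_mem_fil hb hd _ hw)) (by simpa using hn)
    rw [hs.deg_star, degM_cons]
    linarith

/-- On monomials of the same degree as `T`, the functional `ψ_T` is a multiple of the coefficient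
of `z_T`, where the factor is a positive integer times the product of the `Λ ⁅b (star j), b j⁆`. -/
theorem pairing_mono [CharZero k] (hb : IsCharacterDatum b Λ) (hd : IsHeisenbergDegree b Λ deg)
    (hs : IsDualFamily b Λ deg star) (hψ0 : ψ 0 = Finsupp.lapply 0)
    (hψ : ∀ j T, (∀ t ∈ T, j ≤ t) → ∀ p, ψ (j ::ₘ T) p =
      ψ T (rep b Λ hb (b (Sum.inr (star j))) p))
    (T : Multiset ι) :
    (∀ F, degM deg F = degM deg T → F ≠ T → ψ T (mono k F) = 0) ∧
      (ψ T (mono k T) = 0 ↔ ∃ j ∈ T, Λ ⁅b (Sum.inr (star j)), b (Sum.inl j)⁆ = 0) := by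
  induction hn : T.card generalizing T with
  | zero =>
    obtain rfl : T = 0 := by simpa using hn
    rw [hψ0]
    refine ⟨fun F _ hF => ?_, by simp⟩
    rw [Finsupp.lapply_apply, Finsupp.single_apply, if_neg hF]
  | succ n ih =>
    obtain ⟨⟨j, T⟩, rfl, hj⟩ := Multiset.exists_eq_cons_le (M := T) (by rintro rfl; simp at hn)
    obtain ⟨ih1, ih2⟩ := ih T (by simpa using hn)
    dsimp only
    -- on monomials of this degree, `b (star j)` is a multiple of the derivative along `z_j`
    have key : ∀ F, degM deg F = degM deg (j ::ₘ T) → ψ (j ::ₘ T) (mono k F) =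
        F.count j • (Λ ⁅b (Sum.inr (star j)), b (Sum.inl j)⁆ * ψ T (mono k (F.erase j))) := by
      intro F hF
      have h1 := rep_sub_symbolMono_mem hb hd _ F le_rfl (Sum.inr (star j))
      have h2 := pairing_eq_zero_of_lt hb hd hs hψ0 hψ T (fil_anti (by
        rw [hF, hs.deg_star, degM_cons]; linarith) h1)
      rw [map_sub, sub_eq_zero] at h2
      rw [hψ j T hj, h2]
      simp only [symbolMono, Sum.elim_inr, hs.map_star, zero_smul, zero_add, map_multiset_sum,
        Multiset.map_map, Function.comp_def, map_smul]
      have h3 : F.map (fun l => Λ ⁅b (Sum.inr (star j)), b (Sum.inl l)⁆ •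
          ψ T (mono k (F.erase l))) = F.map (fun l => if l = j then
            Λ ⁅b (Sum.inr (star j)), b (Sum.inl j)⁆ * ψ T (mono k (F.erase j)) else 0) := by
        refine Multiset.map_congr rfl fun l hl => ?_
        split_ifs with hlj
        · subst hlj; rfl
        · by_cases h0 : Λ ⁅b (Sum.inr (star j)), b (Sum.inl l)⁆ = 0
          · rw [h0, zero_smul]
          · have hlt := hs.map_lie_star j l hlj h0
            rw [pairing_eq_zero_of_lt hb hd hs hψ0 hψ T (mono_mem_fil _), smul_zero]
            rw [degM_erase deg hl, hF, degM_cons]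
            linarith
      rw [h3, Finset.sum_multiset_map_count]
      simp only [smul_ite, smul_zero, Finset.sum_ite_eq', Multiset.mem_toFinset]
      split_ifs with hjF
      · rfl
      · rw [Multiset.count_eq_zero_of_notMem hjF, zero_smul]
    constructor
    · intro F hF hne
      rw [key F hF]
      by_cases hjF : j ∈ F
      · rw [ih1, mul_zero, smul_zero]
        · rw [degM_erase deg hjF, hF, degM_cons]
          ring
        · rintro rfl
          exact hne (Multiset.cons_erase hjF).symm
      · rw [Multiset.count_eq_zero_of_notMem hjF, zero_smul]
    · rw [key _ rfl, Multiset.erase_cons_head, smul_eq_zero, mul_eq_zero, ih2]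
      simp

end InducedModule

namespace InducedModule

attribute [local instance] LieRing.ofAssociativeRing

/-! ### Weights of the module of monomials -/

/-- The sum of the weights of the elements of a multiset. -/
def wtM {ι A : Type*} [AddCommMonoid A] (wt : ι → A) (M : Multiset ι) : A := (M.map wt).sum

section

variable {ι A : Type*} [AddCommMonoid A] (wt : ι → A)

@[simp] theorem wtM_zero : wtM wt 0 = 0 := rfl

@[simp] theorem wtM_cons (j : ι) (M : Multiset ι) : wtM wt (j ::ₘ M) = wt j + wtM wt M := by
  simp [wtM]

end

/-- The span of the monomials `z_M` for which `M` has weight `β`. -/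
noncomputable def wtSpace (k : Type*) [Field k] {ι A : Type*} [AddCommMonoid A] (wt : ι → A)
    (β : A) : Submodule k (Multiset ι →₀ k) :=
  Finsupp.supported k k {M | wtM wt M = β}

section

variable {k ι H : Type*} [Field k] [AddCommGroup H] [Module k H] {wt : ι → Module.Dual k H}

theorem apply_zero_of_mem_wtSpace {β : Module.Dual k H} (hβ : β ≠ 0) {p : Multiset ι →₀ k}
    (hp : p ∈ wtSpace k wt β) : p 0 = 0 := by
  by_contra h
  exact hβ (show wtM wt 0 = β from hp (Finsupp.mem_support_iff.2 h)).symm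

theorem mono_mem_wtSpace (M : Multiset ι) : mono k M ∈ wtSpace k wt (wtM wt M) :=
  Finsupp.single_mem_supported k _ rfl

end

variable {k L ι ι' H : Type*} [Field k] [LieRing L] [LieAlgebra k L] [LinearOrder ι]
  [AddCommGroup H] [Module k H]
  {b : Module.Basis (ι ⊕ ι') k L} {Λ : L →ₗ[k] k}

variable (b) in
/-- A torus in the subalgebra: an abelian family `τ` of elements which act on the basis vectors of
the complement by the weights `-wt i`, such that no sum of these weights vanishes. -/
structure IsTorus (τ : H → L) (wt : ι → Module.Dual k H) : Prop where
  mem : ∀ a, τ a ∈ Submodule.span k (Set.range fun l => b (Sum.inr l))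
  lie : ∀ a i, ⁅τ a, b (Sum.inl i)⁆ = -(wt i a) • b (Sum.inl i)
  pointed : ∀ M, wtM wt M = 0 → M = 0

variable {τ : H → L} {wt : ι → Module.Dual k H}

theorem rep_torus_mono (hb : IsCharacterDatum b Λ) (ht : IsTorus b τ wt) (a : H)
    (M : Multiset ι) :
    rep b Λ hb (τ a) (mono k M) = (Λ (τ a) - wtM wt M a) • mono k M := by
  induction hn : M.card generalizing M with
  | zero =>
    obtain rfl : M = 0 := by simpa using hn
    rw [rep_zero hb (ht.mem a), wtM_zero, LinearMap.zero_apply, sub_zero]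
  | succ n ih =>
    obtain ⟨⟨j, T⟩, rfl, hj⟩ := Multiset.exists_eq_cons_le (M := M) (by rintro rfl; simp at hn)
    dsimp only
    rw [← rep_inl hb hj, rep_lie_apply, ih T (by simpa using hn), ht.lie, map_smul, map_smul,
      LinearMap.smul_apply, ← add_smul, wtM_cons, LinearMap.add_apply]
    congr 1
    ring

theorem rep_torus_apply (hb : IsCharacterDatum b Λ) (ht : IsTorus b τ wt) (a : H)
    (p : Multiset ι →₀ k) (M : Multiset ι) :
    rep b Λ hb (τ a) p M = (Λ (τ a) - wtM wt M a) * p M := by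
  induction p using Finsupp.induction_linear with
  | zero => simp
  | add f g hf hg => rw [map_add, Finsupp.add_apply, hf, hg, Finsupp.add_apply, mul_add]
  | single F c =>
    have h : (Finsupp.single F c : Multiset ι →₀ k) = c • mono k F := by simp
    rw [h, map_smul, rep_torus_mono hb ht]
    simp only [Finsupp.smul_apply, Finsupp.single_apply, smul_eq_mul]
    split_ifs with hFM
    · subst hFM; ring
    · simp

/-- The joint eigenspaces of the torus are the spans of the monomials of a given weight. -/
theorem mem_wtSpace_iff (hb : IsCharacterDatum b Λ) (ht : IsTorus b τ wt)
    (β : Module.Dual k H) (p : Multiset ι →₀ k) :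
    p ∈ wtSpace k wt β ↔ ∀ a, rep b Λ hb (τ a) p = (Λ (τ a) - β a) • p := by
  constructor
  · intro hp a
    ext M
    rw [rep_torus_apply hb ht, Finsupp.smul_apply, smul_eq_mul]
    by_cases h : p M = 0
    · simp [h]
    · rw [show wtM wt M = β from hp (Finsupp.mem_support_iff.2 h)]
  · intro h M hM
    refine LinearMap.ext fun a => ?_
    have h1 := DFunLike.congr_fun (h a) M
    rw [rep_torus_apply hb ht, Finsupp.smul_apply, smul_eq_mul] at h1
    have h2 := mul_right_cancel₀ (Finsupp.mem_support_iff.1 hM) h1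
    linear_combination -h2

theorem rep_mem_wtSpace (hb : IsCharacterDatum b Λ) (ht : IsTorus b τ wt)
    {β γ : Module.Dual k H} {p : Multiset ι →₀ k} (hp : p ∈ wtSpace k wt β) {y : L}
    (hy : ∀ a, ⁅τ a, y⁆ = -(γ a) • y) : rep b Λ hb y p ∈ wtSpace k wt (γ + β) := by
  rw [mem_wtSpace_iff hb ht] at hp ⊢
  intro a
  rw [rep_lie_apply, hp, hy, map_smul, map_smul, LinearMap.smul_apply, ← add_smul,
    LinearMap.add_apply]
  congr 1
  ring

/-- The constant coefficient vanishes on the image of an element that lowers weights. -/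
theorem rep_apply_zero_of_lowering (hb : IsCharacterDatum b Λ) (ht : IsTorus b τ wt) (j : ι)
    {y : L} (hy : ∀ a, ⁅τ a, y⁆ = -(wt j a) • y) (p : Multiset ι →₀ k) :
    rep b Λ hb y p 0 = 0 := by
  induction p using Finsupp.induction_linear with
  | zero => simp
  | add f g hf hg => rw [map_add, Finsupp.add_apply, hf, hg, add_zero]
  | single M c =>
    have h : (Finsupp.single M c : Multiset ι →₀ k) = c • mono k M := by simp
    rw [h, map_smul, Finsupp.smul_apply,
      apply_zero_of_mem_wtSpace _ (rep_mem_wtSpace hb ht (mono_mem_wtSpace M) hy), smul_zero]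
    rw [← wtM_cons]
    exact fun h0 => Multiset.cons_ne_zero (ht.pointed _ h0)

/-- The constant coefficient is an eigenfunctional for the elements of the subalgebra that commute
with the torus. -/
theorem rep_apply_zero_of_commute (hb : IsCharacterDatum b Λ) (ht : IsTorus b τ wt)
    {y : L} (hy : ∀ a, ⁅τ a, y⁆ = 0)
    (hy' : y ∈ Submodule.span k (Set.range fun l => b (Sum.inr l))) (p : Multiset ι →₀ k) :
    rep b Λ hb y p 0 = Λ y * p 0 := by
  induction p using Finsupp.induction_linear with
  | zero => simp
  | add f g hf hg => rw [map_add, Finsupp.add_apply, hf, hg, Finsupp.add_apply, mul_add]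
  | single M c =>
    have h : (Finsupp.single M c : Multiset ι →₀ k) = c • mono k M := by simp
    rw [h, map_smul]
    by_cases hM : M = 0
    · subst hM
      rw [rep_zero hb hy']
      simp [mul_comm]
    · have h1 := rep_mem_wtSpace hb ht (mono_mem_wtSpace (k := k) (wt := wt) M) (γ := 0)
        (y := y) (by simpa using hy)
      rw [Finsupp.smul_apply, apply_zero_of_mem_wtSpace _ h1, Finsupp.smul_apply,
        Finsupp.single_apply, if_neg hM, smul_zero, mul_zero]
      rw [zero_add]
      exact fun h0 => hM (ht.pointed _ h0)

/-- A subspace stable under the torus that contains a vector with non-zero constant coefficient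
contains the monomial `1`. -/
theorem mono_zero_mem_of_apply_zero_ne_zero (hb : IsCharacterDatum b Λ) (ht : IsTorus b τ wt)
    (W : Submodule k (Multiset ι →₀ k)) (hW : ∀ a, ∀ p ∈ W, rep b Λ hb (τ a) p ∈ W)
    {p : Multiset ι →₀ k} (hp : p ∈ W) (h0 : p 0 ≠ 0) : mono k 0 ∈ W := by
  induction hn : p.support.card using Nat.strong_induction_on generalizing p with
  | _ n ih =>
    by_cases hM : ∃ M ∈ p.support, M ≠ 0
    · obtain ⟨M, hM, hM0⟩ := hM
      obtain ⟨a, ha⟩ : ∃ a, wtM wt M a ≠ 0 := by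
        by_contra! h
        exact hM0 (ht.pointed _ (LinearMap.ext h))
      -- subtracting the eigenvalue at `M` removes the monomial `z_M`
      let p' := rep b Λ hb (τ a) p - (Λ (τ a) - wtM wt M a) • p
      have hp' : ∀ F, p' F = (wtM wt M a - wtM wt F a) * p F := by
        intro F
        simp only [p', Finsupp.sub_apply, Finsupp.smul_apply, smul_eq_mul, rep_torus_apply hb ht]
        ring
      refine ih p'.support.card ?_ (sub_mem (hW a p hp) (W.smul_mem _ hp)) ?_ rfl
      · rw [← hn]
        apply Finset.card_lt_card
        refine ⟨fun F hF => ?_, fun h => ?_⟩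
        · rw [Finsupp.mem_support_iff, hp'] at hF
          exact Finsupp.mem_support_iff.2 (right_ne_zero_of_mul hF)
        · have := h hM
          rw [Finsupp.mem_support_iff, hp', sub_self, zero_mul] at this
          exact this rfl
      · rw [hp']
        simpa using ⟨ha, h0⟩
    · push Not at hM
      have h1 : p = p 0 • mono k 0 := by
        ext F
        by_cases hF : F = 0
        · subst hF; simp
        · have : p F = 0 := by
            by_contra h
            exact hF (hM F (Finsupp.mem_support_iff.2 h))
          rw [this, Finsupp.smul_apply, Finsupp.single_apply, if_neg (Ne.symm hF), smul_zero]
      have h2 := W.smul_mem (p 0)⁻¹ hp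
      rw [h1, smul_smul] at h2
      simpa [h0] using h2

/-! ### The contravariant pairing -/

variable (b Λ) in
/-- The representation on the dual space obtained from an anti-automorphism of the Lie algebra. -/
noncomputable def dualRep (hb : IsCharacterDatum b Λ) (ω : L →ₗ[k] L)
    (hω : ∀ x y, ω ⁅x, y⁆ = ⁅ω y, ω x⁆) :
    L →ₗ⁅k⁆ Module.End k (Module.Dual k (Multiset ι →₀ k)) where
  toFun x := (rep b Λ hb (ω x)).dualMap
  map_add' x y := by ext; simp
  map_smul' c x := by ext; simp
  map_lie' {x y} := by
    refine LinearMap.ext fun f => LinearMap.ext fun p => ?_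
    simp [hω, Ring.lie_def]

theorem dualRep_apply (hb : IsCharacterDatum b Λ) (ω : L →ₗ[k] L)
    (hω : ∀ x y, ω ⁅x, y⁆ = ⁅ω y, ω x⁆) (x : L) (f : Module.Dual k (Multiset ι →₀ k))
    (p : Multiset ι →₀ k) : dualRep b Λ hb ω hω x f p = f (rep b Λ hb (ω x) p) :=
  rfl

variable (b Λ) in
/-- An anti-involution `ω` of the Lie algebra, together with a second basis `c` adapted to the same
subalgebra whose vectors in the complement are the images under `ω` of the basis vectors
`b (star j)`. -/
structure IsContravariant (τ : H → L) (wt : ι → Module.Dual k H) (c : Module.Basis (ι ⊕ ι') k L)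
    (ω : L →ₗ[k] L) (star : ι → ι') : Prop where
  datum : IsCharacterDatum c Λ
  map_lie : ∀ x y, ω ⁅x, y⁆ = ⁅ω y, ω x⁆
  invol : ∀ x, ω (ω x) = x
  map_inl : ∀ j, ω (c (Sum.inl j)) = b (Sum.inr (star j))
  lie_star : ∀ a j, ⁅τ a, b (Sum.inr (star j))⁆ = wt j a • b (Sum.inr (star j))
  map_inr : ∀ i, (Λ (c (Sum.inr i)) = 0 ∧ ∃ j, ∀ a, ⁅τ a, ω (c (Sum.inr i))⁆ =
      -(wt j a) • ω (c (Sum.inr i))) ∨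
    ω (c (Sum.inr i)) = c (Sum.inr i) ∧ (∀ a, ⁅τ a, c (Sum.inr i)⁆ = 0) ∧
      c (Sum.inr i) ∈ Submodule.span k (Set.range fun l => b (Sum.inr l))

variable {c : Module.Basis (ι ⊕ ι') k L} {ω : L →ₗ[k] L} {star : ι → ι'}

variable (b Λ c ω) in
/-- The functional that a monomial in the second basis obtains from the constant coefficient. -/
noncomputable def pairing (hb : IsCharacterDatum b Λ) (hω : ∀ x y, ω ⁅x, y⁆ = ⁅ω y, ω x⁆)
    (T : Multiset ι) : Module.Dual k (Multiset ι →₀ k) :=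
  fromMono c (dualRep b Λ hb ω hω) (Finsupp.lapply 0) (mono k T)

theorem pairing_zero (hb : IsCharacterDatum b Λ) (hω : ∀ x y, ω ⁅x, y⁆ = ⁅ω y, ω x⁆) :
    pairing b Λ c ω hb hω 0 = Finsupp.lapply 0 :=
  fromMono_zero _ _

theorem pairing_cons (hb : IsCharacterDatum b Λ) (hc : IsContravariant b Λ τ wt c ω star) (j : ι)
    (T : Multiset ι) (hj : ∀ t ∈ T, j ≤ t) (p : Multiset ι →₀ k) :
    pairing b Λ c ω hb hc.map_lie (j ::ₘ T) p =
      pairing b Λ c ω hb hc.map_lie T (rep b Λ hb (b (Sum.inr (star j))) p) := by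
  rw [pairing, fromMono_cons _ _ hj, dualRep_apply, hc.map_inl]
  rfl

theorem exists_pairing_eq (hb : IsCharacterDatum b Λ) (hc : IsContravariant b Λ τ wt c ω star)
    (T : Multiset ι) : ∃ u, ∀ p, pairing b Λ c ω hb hc.map_lie T p = envRep b Λ hb u p 0 := by
  induction hn : T.card generalizing T with
  | zero =>
    obtain rfl : T = 0 := by simpa using hn
    exact ⟨1, fun p => by rw [pairing_zero]; simp⟩
  | succ n ih =>
    obtain ⟨⟨j, T⟩, rfl, hj⟩ := Multiset.exists_eq_cons_le (M := T) (by rintro rfl; simp at hn)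
    obtain ⟨u, hu⟩ := ih T (by simpa using hn)
    refine ⟨u * UniversalEnvelopingAlgebra.ι k (b (Sum.inr (star j))), fun p => ?_⟩
    rw [pairing_cons hb hc j T hj, hu, map_mul, Module.End.mul_apply, envRep_ι]

/-- The functionals `pairing T` span a right submodule: a vector that they all kill generates a
submodule on which the constant coefficient vanishes. -/
theorem envRep_apply_zero_of_pairing_eq_zero (hb : IsCharacterDatum b Λ) (ht : IsTorus b τ wt)
    (hc : IsContravariant b Λ τ wt c ω star) {p : Multiset ι →₀ k}
    (hp : ∀ T, pairing b Λ c ω hb hc.map_lie T p = 0) (u : UniversalEnvelopingAlgebra k L) :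
    envRep b Λ hb u p 0 = 0 := by
  let q := fromMono c (dualRep b Λ hb ω hc.map_lie) (Finsupp.lapply 0)
  have hq : ∀ x f, q (rep c Λ hc.datum x f) = dualRep b Λ hb ω hc.map_lie x (q f) := by
    refine fromMono_rep _ _ hc.datum fun i => LinearMap.ext fun p => ?_
    rw [dualRep_apply, LinearMap.smul_apply, Finsupp.lapply_apply, Finsupp.lapply_apply,
      smul_eq_mul]
    rcases hc.map_inr i with ⟨h1, j, hj⟩ | ⟨h1, h2, h3⟩
    · rw [h1, zero_mul, rep_apply_zero_of_lowering hb ht j hj]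
    · rw [h1, rep_apply_zero_of_commute hb ht h2 h3]
  have hstable : ∀ u : UniversalEnvelopingAlgebra k L, ∀ f ∈ LinearMap.range q,
      f ∘ₗ envRep b Λ hb u ∈ LinearMap.range q := by
    intro u
    induction u using UniversalEnvelopingAlgebra.induction_on with
    | algebraMap c =>
      intro f hf
      convert (LinearMap.range q).smul_mem c hf using 1
      refine LinearMap.ext fun p => ?_
      simp [AlgHom.commutes, Module.algebraMap_end_apply]
    | ι x =>
      rintro _ ⟨f, rfl⟩
      refine ⟨rep c Λ hc.datum (ω x) f, ?_⟩
      rw [hq]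
      refine LinearMap.ext fun p => ?_
      rw [dualRep_apply, hc.invol, LinearMap.comp_apply, envRep_ι]
    | add u v hu hv =>
      intro f hf
      rw [map_add, LinearMap.comp_add]
      exact add_mem (hu f hf) (hv f hf)
    | mul u v hu hv =>
      intro f hf
      rw [map_mul, Module.End.mul_eq_comp, ← LinearMap.comp_assoc]
      exact hv _ (hu f hf)
  have h0 : (Finsupp.lapply 0 : Module.Dual k (Multiset ι →₀ k)) ∈ LinearMap.range q :=
    ⟨mono k 0, fromMono_zero _ _⟩
  obtain ⟨f, hf⟩ := hstable u _ h0
  have h1 : q f p = 0 := by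
    have : q.flip p = 0 := Finsupp.lhom_ext' fun M => LinearMap.ext_ring (hp M)
    exact DFunLike.congr_fun this f
  rw [hf] at h1
  exact h1

theorem pairing_eq_zero_of_wtM_ne (hb : IsCharacterDatum b Λ) (ht : IsTorus b τ wt)
    (hc : IsContravariant b Λ τ wt c ω star) (T : Multiset ι) {β : Module.Dual k H}
    (hβ : wtM wt T ≠ β) {p : Multiset ι →₀ k} (hp : p ∈ wtSpace k wt β) :
    pairing b Λ c ω hb hc.map_lie T p = 0 := by
  induction hn : T.card generalizing T β p with
  | zero =>
    obtain rfl : T = 0 := by simpa using hn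
    rw [pairing_zero, Finsupp.lapply_apply]
    exact apply_zero_of_mem_wtSpace (Ne.symm hβ) hp
  | succ n ih =>
    obtain ⟨⟨j, T⟩, rfl, hj⟩ := Multiset.exists_eq_cons_le (M := T) (by rintro rfl; simp at hn)
    rw [pairing_cons hb hc j T hj]
    refine ih T (β := -wt j + β) (fun h => hβ ?_) (rep_mem_wtSpace hb ht hp fun a => ?_)
      (by simpa using hn)
    · rw [wtM_cons, h]
      abel
    · rw [hc.lie_star, LinearMap.neg_apply, neg_neg]

variable {deg : ι ⊕ ι' → ℤ}

/-- If a non-zero vector generates a submodule on which the constant coefficient vanishes, then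
one of the monomials in it involves a variable with vanishing dual pairing. -/
theorem exists_map_lie_star_eq_zero [CharZero k] (hb : IsCharacterDatum b Λ)
    (hd : IsHeisenbergDegree b Λ deg) (hs : IsDualFamily b Λ deg star)
    (hc : IsContravariant b Λ τ wt c ω star) {p : Multiset ι →₀ k} (hp : p ≠ 0)
    (h : ∀ u, envRep b Λ hb u p 0 = 0) :
    ∃ F ∈ p.support, ∃ j ∈ F, Λ ⁅b (Sum.inr (star j)), b (Sum.inl j)⁆ = 0 := by
  -- in the support of `p`, the functional of a monomial of least degree sees that monomial only
  obtain ⟨F, hF, hmin⟩ := p.support.exists_min_image (degM deg) (Finsupp.support_nonempty_iff.2 hp)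
  have h1 := pairing_mono hb hd hs (pairing_zero hb hc.map_lie) (pairing_cons hb hc) F
  refine ⟨F, hF, h1.2.1 ?_⟩
  obtain ⟨u, hu⟩ := exists_pairing_eq hb hc F
  have h2 := hu p
  rw [h u] at h2
  have h3 : pairing b Λ c ω hb hc.map_lie F p =
      p F * pairing b Λ c ω hb hc.map_lie F (mono k F) := by
    conv_lhs => rw [← Finsupp.sum_single p]
    rw [Finsupp.sum, map_sum, Finset.sum_eq_single F]
    · rw [← smul_eq_mul, ← map_smul, Finsupp.smul_single, smul_eq_mul, mul_one]
    · intro M hM hne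
      rw [← mul_one (p M), ← smul_eq_mul, ← Finsupp.smul_single, map_smul]
      rcases (hmin M hM).eq_or_lt with heq | hlt
      · rw [h1.1 M heq.symm hne, smul_zero]
      · rw [pairing_eq_zero_of_lt hb hd hs (pairing_zero hb hc.map_lie) (pairing_cons hb hc) F
          (mono_mem_fil hlt), smul_zero]
    · exact fun h => absurd hF h
  rw [h3] at h2
  exact (mul_eq_zero.1 h2).resolve_left (Finsupp.mem_support_iff.1 hF)

/-- If a monomial of weight `χ` involves a variable with vanishing dual pairing, then some non-zero
vector of weight `χ` generates a submodule on which the constant coefficient vanishes. -/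
theorem exists_mem_wtSpace_of_map_lie_star_eq_zero [CharZero k] (hb : IsCharacterDatum b Λ)
    (ht : IsTorus b τ wt) (hd : IsHeisenbergDegree b Λ deg) (hs : IsDualFamily b Λ deg star)
    (hc : IsContravariant b Λ τ wt c ω star) {χ : Module.Dual k H}
    (hfin : {M | wtM wt M = χ}.Finite) {F : Multiset ι} (hF : wtM wt F = χ) {j : ι} (hj : j ∈ F)
    (h : Λ ⁅b (Sum.inr (star j)), b (Sum.inl j)⁆ = 0) :
    ∃ p ∈ wtSpace k wt χ, p ≠ 0 ∧ ∀ u, envRep b Λ hb u p 0 = 0 := by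
  classical
  -- the unknowns are the coefficients of `F` and of the monomials of larger degree, the equations
  -- are the functionals of the latter: there are more unknowns than equations, and the functionals
  -- of all other monomials vanish on these unknowns
  let E : Finset (Multiset ι) := hfin.toFinset.filter fun M => degM deg F < degM deg M
  have hFE : F ∉ E := by simp [E]
  let g : (↥(insert F E) → k) →ₗ[k] (↥E → k) :=
    LinearMap.pi fun T => ∑ M, (LinearMap.proj M).smulRight
      (pairing b Λ c ω hb hc.map_lie T (mono k M.1))
  have hg : LinearMap.ker g ≠ ⊥ := by
    apply LinearMap.ker_ne_bot_of_finrank_lt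
    simp [Finset.card_insert_of_notMem hFE]
  obtain ⟨x, hx, hx0⟩ := (Submodule.ne_bot_iff _).1 hg
  let p : Multiset ι →₀ k := ∑ M, x M • mono k M.1
  have hpx : ∀ M, p M.1 = x M := by
    intro M
    simp only [p, Finsupp.finsetSum_apply, Finsupp.smul_apply, Finsupp.single_apply, smul_eq_mul,
      mul_ite, mul_one, mul_zero]
    rw [Finset.sum_eq_single M]
    · simp
    · intro M' _ hne
      rw [if_neg fun h => hne (Subtype.ext h)]
    · exact fun h => absurd (Finset.mem_univ _) h
  have hmem : ∀ M ∈ insert F E, wtM wt M = χ ∧ (M = F ∨ degM deg F < degM deg M) := by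
    intro M hM
    rcases Finset.mem_insert.1 hM with rfl | hM
    · exact ⟨hF, Or.inl rfl⟩
    · simpa [E] using ⟨(by simpa [E] using hM : wtM wt M = χ ∧ _).1,
        Or.inr (by simpa [E] using hM : wtM wt M = χ ∧ _).2⟩
  have hpw : p ∈ wtSpace k wt χ := sum_mem fun M _ =>
    Submodule.smul_mem _ _ ((hmem M.1 M.2).1 ▸ mono_mem_wtSpace M.1)
  refine ⟨p, hpw, ?_, envRep_apply_zero_of_pairing_eq_zero hb ht hc fun T => ?_⟩
  · rintro h0
    apply hx0
    funext M
    rw [← hpx, h0]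
    rfl
  have hψ0 := pairing_zero (c := c) hb hc.map_lie
  have h1 := pairing_mono hb hd hs hψ0 (pairing_cons hb hc) T
  have h2 : ∀ {w}, w ∈ fil deg k (degM deg T + 1) → pairing b Λ c ω hb hc.map_lie T w = 0 :=
    pairing_eq_zero_of_lt hb hd hs hψ0 (pairing_cons hb hc) T
  by_cases hT : wtM wt T = χ
  swap
  · exact pairing_eq_zero_of_wtM_ne hb ht hc T hT hpw
  rcases lt_or_ge (degM deg F) (degM deg T) with hlt | hle
  · have hTE : T ∈ E := by simpa [E] using ⟨hT, hlt⟩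
    have := congrFun hx ⟨T, hTE⟩
    rw [← show g x ⟨T, hTE⟩ = pairing b Λ c ω hb hc.map_lie T p by
      simp only [g, p, LinearMap.pi_apply, LinearMap.sum_apply, LinearMap.smulRight_apply,
        LinearMap.proj_apply, map_sum, map_smul]]
    exact this
  · simp only [p, map_sum, map_smul]
    refine Finset.sum_eq_zero fun M _ => ?_
    rcases (hmem M.1 M.2).2 with hMF | hlt
    · rw [hMF]
      rcases hle.eq_or_lt with heq | hlt
      · by_cases hTF : T = F
        · subst hTF
          rw [h1.2.2 ⟨j, hj, h⟩, smul_zero]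
        · rw [h1.1 F heq.symm (Ne.symm hTF), smul_zero]
      · rw [h2 (mono_mem_fil hlt), smul_zero]
    · rw [h2 (mono_mem_fil (lt_of_le_of_lt hle hlt)), smul_zero]

end InducedModule

/-! ### The monoid generated by the positive roots -/

namespace TriangularDecomposition

variable {k g : Type*} [Field k] [LieRing g] [LieAlgebra k g] (T : TriangularDecomposition k g)

theorem posCone_eq_closure {S : Set (Module.Dual k T.h₀)}
    (hS : AddSubmonoid.closure S =
      AddSubmonoid.closure {α | adWeightSpace T.h₀ α ⊓ T.pos.toSubmodule ≠ ⊥}) :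
    T.posCone = AddSubmonoid.closure S :=
  hS.symm

/-- The height: a linear functional with natural values on `Q₊` that vanishes only at `0`. -/
theorem exists_height : ∃ ht : Module.Dual k T.h₀ →ₗ[k] k, ∀ x ∈ T.posCone,
    ∃ n : ℕ, ht x = n ∧ (n = 0 → x = 0) := by
  obtain ⟨S, hS, hS'⟩ := T.exists_base
  have hli : LinearIndependent k (fun s : S => (s : Module.Dual k T.h₀)) := hS
  obtain ⟨ht, hht⟩ := LinearMap.exists_extend
    ((Module.Basis.span hli).constr k fun _ => (1 : k))
  have h1 : ∀ s ∈ S, ht s = 1 := by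
    intro s hs
    have h2 := LinearMap.congr_fun hht (Module.Basis.span hli ⟨s, hs⟩)
    rw [Module.Basis.constr_basis, LinearMap.comp_apply, Submodule.subtype_apply,
      Module.Basis.span_apply] at h2
    exact h2
  refine ⟨ht, fun x hx => ?_⟩
  rw [posCone_eq_closure T hS'] at hx
  induction hx using AddSubmonoid.closure_induction with
  | mem x hx => exact ⟨1, by simp [h1 x hx], by simp⟩
  | zero => exact ⟨0, by simp⟩
  | add x y _ _ hx hy =>
    obtain ⟨n, hn, hn'⟩ := hx
    obtain ⟨m, hm, hm'⟩ := hy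
    refine ⟨n + m, by simp [hn, hm], fun h => ?_⟩
    rw [hn' (by omega), hm' (by omega), add_zero]

/-- The order interval `[0, χ]` is finite in the free commutative monoid `Q₊`. -/
theorem finite_le_posCone [CharZero k] {χ : Module.Dual k T.h₀} (hχ : χ ∈ T.posCone) :
    {α | α ∈ T.posCone ∧ χ - α ∈ T.posCone}.Finite := by
  classical
  obtain ⟨S, hS, hS'⟩ := T.exists_base
  have hli : LinearIndependent k (fun s : S => (s : Module.Dual k T.h₀)) := hS
  have hliN : LinearIndependent ℕ (fun s : S => (s : Module.Dual k T.h₀)) :=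
    hli.restrict_scalars (by
      intro m n h
      simpa using h)
  let Φ : (S →₀ ℕ) →ₗ[ℕ] Module.Dual k T.h₀ :=
    Finsupp.linearCombination ℕ (fun s : S => (s : Module.Dual k T.h₀))
  have hsurj : ∀ x ∈ T.posCone, ∃ f, Φ f = x := by
    intro x hx
    rw [posCone_eq_closure T hS'] at hx
    have : AddSubmonoid.closure S ≤ (LinearMap.range Φ).toAddSubmonoid := by
      rw [AddSubmonoid.closure_le]
      intro s hs
      exact ⟨Finsupp.single ⟨s, hs⟩ 1, by simp [Φ]⟩
    exact this hx
  obtain ⟨f, rfl⟩ := hsurj χ hχ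
  refine ((Set.finite_Iic f).image Φ).subset ?_
  rintro α ⟨hα, hβ⟩
  obtain ⟨f₁, rfl⟩ := hsurj α hα
  obtain ⟨f₂, hf₂⟩ := hsurj _ hβ
  have h : f = f₁ + f₂ := hliN (by
    change Φ f = Φ (f₁ + f₂)
    rw [map_add, hf₂]
    abel)
  exact ⟨f₁, Set.mem_Iic.2 (h.symm ▸ le_self_add), rfl⟩

variable {T}

theorem ne_zero_of_mem_posRoots {α : Module.Dual k T.h₀} (hα : α ∈ T.posRoots) : α ≠ 0 := by
  rintro rfl
  exact hα T.pos_weight_ne_zero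

theorem mem_posCone_of_mem_posRoots {α : Module.Dual k T.h₀} (hα : α ∈ T.posRoots) :
    α ∈ T.posCone :=
  AddSubmonoid.subset_closure hα

open InducedModule in
theorem wtM_mem_posCone {ι : Type*} {wt : ι → Module.Dual k T.h₀} (hwt : ∀ i, wt i ∈ T.posRoots)
    (M : Multiset ι) : wtM wt M ∈ T.posCone :=
  AddSubmonoid.multiset_sum_mem _ _ fun x hx => by
    obtain ⟨i, -, rfl⟩ := Multiset.mem_map.1 hx
    exact mem_posCone_of_mem_posRoots (hwt i)

open InducedModule in
/-- The height of a sum of positive roots is at least the number of summands. -/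
theorem exists_card_le_height [CharZero k] {ι : Type*} {wt : ι → Module.Dual k T.h₀}
    (hwt : ∀ i, wt i ∈ T.posRoots) : ∃ ht : Module.Dual k T.h₀ →ₗ[k] k,
      ∀ M : Multiset ι, ∃ n : ℕ, ht (wtM wt M) = n ∧ M.card ≤ n := by
  obtain ⟨ht, hht⟩ := T.exists_height
  refine ⟨ht, fun M => ?_⟩
  induction M using Multiset.induction_on with
  | empty => exact ⟨0, by simp⟩
  | cons j M ih =>
    obtain ⟨n, hn, hn'⟩ := ih
    obtain ⟨m, hm, hm'⟩ := hht _ (mem_posCone_of_mem_posRoots (hwt j))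
    have : m ≠ 0 := fun h => ne_zero_of_mem_posRoots (hwt j) (hm' h)
    refine ⟨m + n, by simp [hn, hm], ?_⟩
    rw [Multiset.card_cons]
    omega

open InducedModule in
theorem eq_zero_of_wtM_eq_zero [CharZero k] {ι : Type*} {wt : ι → Module.Dual k T.h₀}
    (hwt : ∀ i, wt i ∈ T.posRoots) (M : Multiset ι) (hM : wtM wt M = 0) : M = 0 := by
  obtain ⟨ht, hht⟩ := exists_card_le_height hwt
  obtain ⟨n, hn, hn'⟩ := hht M
  rw [hM, map_zero, eq_comm, Nat.cast_eq_zero] at hn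
  exact Multiset.card_eq_zero.1 (by omega)

open InducedModule in
/-- An element of `Q₊` is in finitely many ways a sum of positive roots, counted with finite
multiplicities. -/
theorem finite_wtM_eq [CharZero k] {ι : Type*} {wt : ι → Module.Dual k T.h₀}
    (hwt : ∀ i, wt i ∈ T.posRoots) (hfin : ∀ α, {i | wt i = α}.Finite) {χ : Module.Dual k T.h₀}
    (hχ : χ ∈ T.posCone) : {M | wtM wt M = χ}.Finite := by
  classical
  obtain ⟨ht, hht⟩ := exists_card_le_height hwt
  obtain ⟨N, hN⟩ : ∃ N, ∀ M, wtM wt M = χ → M.card ≤ N := by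
    by_cases h : ∃ M, wtM wt M = χ
    · obtain ⟨M, rfl⟩ := h
      obtain ⟨n, hn, -⟩ := hht M
      refine ⟨n, fun M' hM' => ?_⟩
      obtain ⟨n', hn', hle⟩ := hht M'
      rw [hM', hn, Nat.cast_inj] at hn'
      omega
    · exact ⟨0, fun M hM => absurd ⟨M, hM⟩ h⟩
  have hI : {i | χ - wt i ∈ T.posCone}.Finite := by
    refine ((T.finite_le_posCone hχ).biUnion fun α _ => hfin α).subset fun i hi => ?_
    simp only [Set.mem_iUnion]
    exact ⟨wt i, ⟨mem_posCone_of_mem_posRoots (hwt i), hi⟩, rfl⟩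
  refine (Multiset.finite_toSet (N • hI.toFinset.val).powerset).subset fun M hM => ?_
  rw [Set.mem_ofPred_eq, Multiset.mem_powerset, Multiset.le_iff_count]
  intro i
  by_cases hi : i ∈ M
  · have hi' : i ∈ hI.toFinset := by
      rw [Set.Finite.mem_toFinset, Set.mem_ofPred_eq, ← show wtM wt M = χ from hM,
        ← Multiset.cons_erase hi, wtM_cons, add_sub_cancel_left]
      exact wtM_mem_posCone hwt _
    rw [Multiset.count_nsmul, Multiset.count_eq_one_of_mem hI.toFinset.nodup hi', mul_one]
    exact (Multiset.count_le_card _ _).trans (hN M hM)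
  · rw [Multiset.count_eq_zero_of_notMem hi]
    exact Nat.zero_le _

/-! ### Root spaces and adapted bases -/

theorem lie_mem_pos {a : g} (ha : a ∈ T.h₀) {x : g} (hx : x ∈ T.pos) : ⁅a, x⁆ ∈ T.pos := by
  have : T.pos.toSubmodule ≤ T.pos.toSubmodule.comap (LieAlgebra.ad k g a : g →ₗ[k] g) := by
    refine T.pos_weight.trans (iSup_le fun α x hx => ?_)
    rw [Submodule.mem_comap, LieAlgebra.ad_apply, hx.1 ⟨a, ha⟩]
    exact T.pos.smul_mem _ hx.2
  exact this hx

theorem lie_ω_eq {a : g} (ha : a ∈ T.h) (x : g) : ⁅a, T.ω x⁆ = -T.ω ⁅a, x⁆ := by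
  rw [T.ω_lie, T.ω_h a ha, lie_skew]

variable (T) in
/-- The map `(p, h, p') ↦ ω p + h + p'`. -/
def sumMap : (T.pos.toSubmodule × (T.h.toSubmodule × T.pos.toSubmodule)) →ₗ[k] g :=
  (T.ω ∘ₗ T.pos.toSubmodule.subtype).coprod
    (T.h.toSubmodule.subtype.coprod T.pos.toSubmodule.subtype)

theorem sumMap_apply (p : T.pos.toSubmodule × (T.h.toSubmodule × T.pos.toSubmodule)) :
    T.sumMap p = T.ω p.1 + (p.2.1 + p.2.2 : g) :=
  rfl

theorem sumMap_bijective : Function.Bijective T.sumMap := by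
  have hind := T.isInternal.submodule_iSupIndep
  have htop := T.isInternal.submodule_iSup_eq_top
  have hmem : ∀ {i j : Fin 3} {x : g}, j ≠ i →
      x ∈ ![T.pos.toSubmodule.map T.ω, T.h.toSubmodule, T.pos.toSubmodule] j →
      x ∈ ⨆ j, ⨆ (_ : j ≠ i),
        ![T.pos.toSubmodule.map T.ω, T.h.toSubmodule, T.pos.toSubmodule] j :=
    fun {i j x} hij hx => Submodule.mem_iSup_of_mem j (Submodule.mem_iSup_of_mem hij hx)
  have hdis : ∀ {i : Fin 3} {x : g},
      x ∈ ![T.pos.toSubmodule.map T.ω, T.h.toSubmodule, T.pos.toSubmodule] i →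
      -x ∈ (⨆ j, ⨆ (_ : j ≠ i),
        ![T.pos.toSubmodule.map T.ω, T.h.toSubmodule, T.pos.toSubmodule] j) → x = 0 :=
    fun {i x} h1 h2 => Submodule.disjoint_def.1 (hind i) x h1 (by simpa using neg_mem h2)
  constructor
  · rw [injective_iff_map_eq_zero]
    rintro ⟨p, h, p'⟩ h0
    rw [sumMap_apply] at h0
    dsimp only at h0
    have hp : T.ω (p : g) ∈ ![T.pos.toSubmodule.map T.ω, T.h.toSubmodule, T.pos.toSubmodule] 0 :=
      ⟨p, p.2, rfl⟩
    have hh : (h : g) ∈ ![T.pos.toSubmodule.map T.ω, T.h.toSubmodule, T.pos.toSubmodule] 1 := h.2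
    have hp' : (p' : g) ∈ ![T.pos.toSubmodule.map T.ω, T.h.toSubmodule, T.pos.toSubmodule] 2 :=
      p'.2
    have e0 : T.ω (p : g) = 0 := hdis hp (by
      rw [neg_eq_of_add_eq_zero_right h0]
      exact add_mem (hmem (by decide) hh) (hmem (by decide) hp'))
    have e1 : (h : g) = 0 := hdis hh (by
      rw [neg_eq_of_add_eq_zero_right (b := T.ω (p : g) + p') (by rw [← h0]; abel)]
      exact add_mem (hmem (by decide) hp) (hmem (by decide) hp'))
    have e2 : (p' : g) = 0 := by simpa [e0, e1] using h0
    have e3 : (p : g) = 0 := by rw [← T.ω_ω p, e0, map_zero]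
    simp only [Prod.mk_eq_zero]
    exact ⟨Subtype.ext e3, Subtype.ext e1, Subtype.ext e2⟩
  · rw [← LinearMap.range_eq_top, eq_top_iff, ← htop]
    refine iSup_le fun i => ?_
    fin_cases i
    · rintro _ ⟨p, hp, rfl⟩
      exact ⟨(⟨p, hp⟩, 0, 0), by simp [sumMap_apply]⟩
    · intro h hh
      exact ⟨(0, ⟨h, hh⟩, 0), by simp [sumMap_apply]⟩
    · intro p hp
      exact ⟨(0, 0, ⟨p, hp⟩), by simp [sumMap_apply]⟩

variable (T) in
/-- The triangular decomposition as a linear equivalence. -/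
noncomputable def sumEquiv :
    (T.pos.toSubmodule × (T.h.toSubmodule × T.pos.toSubmodule)) ≃ₗ[k] g :=
  LinearEquiv.ofBijective T.sumMap sumMap_bijective

theorem sumEquiv_apply (p : T.pos.toSubmodule × (T.h.toSubmodule × T.pos.toSubmodule)) :
    T.sumEquiv p = T.ω p.1 + (p.2.1 + p.2.2 : g) :=
  rfl

variable (T) in
/-- The projection of `𝔤` onto `𝔥` along `𝔤₋ ⊕ 𝔤₊`. -/
noncomputable def hProj : g →ₗ[k] T.h.toSubmodule :=
  LinearMap.fst k _ _ ∘ₗ LinearMap.snd k _ _ ∘ₗ T.sumEquiv.symm.toLinearMap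

theorem hProj_sumEquiv (p : T.pos.toSubmodule × (T.h.toSubmodule × T.pos.toSubmodule)) :
    T.hProj (T.sumEquiv p) = p.2.1 := by
  simp [hProj]

theorem hProj_of_mem_pos {x : g} (hx : x ∈ T.pos) : T.hProj x = 0 := by
  have := hProj_sumEquiv (T := T) (0, 0, ⟨x, hx⟩)
  simpa [sumEquiv_apply] using this

theorem hProj_ω_of_mem_pos {x : g} (hx : x ∈ T.pos) : T.hProj (T.ω x) = 0 := by
  have := hProj_sumEquiv (T := T) (⟨x, hx⟩, 0, 0)
  simpa [sumEquiv_apply] using this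

theorem hProj_of_mem_h {x : g} (hx : x ∈ T.h) : T.hProj x = ⟨x, hx⟩ := by
  have := hProj_sumEquiv (T := T) (0, ⟨x, hx⟩, 0)
  simpa [sumEquiv_apply] using this

/-- The components of a weight vector are weight vectors. -/
theorem components_of_mem_rootSpace {γ : Module.Dual k T.h₀}
    (p : T.pos.toSubmodule × (T.h.toSubmodule × T.pos.toSubmodule))
    (hp : T.sumEquiv p ∈ T.rootSpace γ) :
    (p.1 : g) ∈ T.rootSpace (-γ) ∧ (∀ a, γ a • p.2.1 = 0) ∧ (p.2.2 : g) ∈ T.rootSpace γ := by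
  have key : ∀ a : T.h₀, ⁅(a : g), (p.1 : g)⁆ = -(γ a) • (p.1 : g) ∧ γ a • p.2.1 = 0 ∧
      ⁅(a : g), (p.2.2 : g)⁆ = γ a • (p.2.2 : g) := by
    intro a
    have ha : (a : g) ∈ T.h := T.h₀_le_h a.2
    have h1 : T.sumEquiv (-⟨⁅(a : g), (p.1 : g)⁆, lie_mem_pos a.2 p.1.2⟩, 0,
        ⟨⁅(a : g), (p.2.2 : g)⁆, lie_mem_pos a.2 p.2.2.2⟩) = T.sumEquiv (γ a • p) := by
      rw [map_smul, ← hp a, sumEquiv_apply, sumEquiv_apply, lie_add, lie_add, lie_ω_eq ha,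
        T.h_abelian _ ha _ p.2.1.2]
      simp [-lie_skew]
    have h2 := T.sumEquiv.injective h1
    rw [Prod.ext_iff, Prod.ext_iff] at h2
    obtain ⟨h3, h4, h5⟩ := h2
    refine ⟨?_, h4.symm, congrArg Subtype.val h5⟩
    have h6 := congrArg Subtype.val h3
    simp only [Prod.smul_fst] at h6
    rw [neg_smul, ← neg_eq_iff_eq_neg]
    exact h6
  exact ⟨fun a => (key a).1, fun a => (key a).2.1, fun a => (key a).2.2⟩

theorem hProj_of_mem_rootSpace {γ : Module.Dual k T.h₀} (hγ : γ ≠ 0) {x : g}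
    (hx : x ∈ T.rootSpace γ) : T.hProj x = 0 := by
  obtain ⟨p, rfl⟩ := T.sumEquiv.surjective x
  obtain ⟨a, ha⟩ : ∃ a, γ a ≠ 0 := by
    by_contra! h
    exact hγ (LinearMap.ext h)
  rw [hProj_sumEquiv]
  exact (smul_eq_zero.1 ((components_of_mem_rootSpace p hx).2.1 a)).resolve_left ha

open InducedModule in
theorem neg_notMem_posRoots [CharZero k] {α : Module.Dual k T.h₀} (hα : α ∈ T.posRoots) :
    -α ∉ T.posRoots := by
  intro hα'
  have := eq_zero_of_wtM_eq_zero (T := T) (wt := ((↑) : T.posRoots → Module.Dual k T.h₀))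
    (fun i => i.2) (⟨α, hα⟩ ::ₘ ⟨-α, hα'⟩ ::ₘ 0) (by simp [wtM])
  exact Multiset.cons_ne_zero this

theorem rootSpace_le_pos [CharZero k] {α : Module.Dual k T.h₀} (hα : α ∈ T.posRoots) :
    T.rootSpace α ≤ T.pos.toSubmodule := by
  intro x hx
  obtain ⟨p, rfl⟩ := T.sumEquiv.surjective x
  have h1 : p.2.1 = 0 := by
    rw [← hProj_sumEquiv]
    exact hProj_of_mem_rootSpace (ne_zero_of_mem_posRoots hα) hx
  have h2 : (p.1 : g) = 0 := by
    by_contra h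
    refine neg_notMem_posRoots hα fun h' => h ?_
    exact (Submodule.mem_bot k).1 (h' ▸ ⟨(components_of_mem_rootSpace p hx).1, p.1.2⟩)
  rw [sumEquiv_apply, h1, h2]
  simp

theorem iSup_rootSpace [CharZero k] :
    ⨆ α : T.posRoots, T.rootSpace (α : Module.Dual k T.h₀) = T.pos.toSubmodule := by
  refine le_antisymm (iSup_le fun α => rootSpace_le_pos α.2) (T.pos_weight.trans ?_)
  refine iSup_le fun α => ?_
  by_cases hα : α ∈ T.posRoots
  · exact inf_le_left.trans (le_iSup (fun α : T.posRoots => T.rootSpace α.1) ⟨α, hα⟩)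
  · rw [show adWeightSpace T.h₀ α ⊓ T.pos.toSubmodule = ⊥ from not_not.1 hα]
    exact bot_le

theorem iSupIndep_rootSpace : iSupIndep fun α : T.posRoots => T.rootSpace α.1 := by
  let f : T.h₀ → Module.End k g := fun a => LieAlgebra.ad k g (a : g)
  have hf : ∀ a x, f a x = ⁅(a : g), x⁆ := fun a x => rfl
  have h1 := Module.End.independent_iInf_maxGenEigenspace_of_forall_mapsTo f (by
      intro a a' φ
      apply Module.End.mapsTo_maxGenEigenspace_of_comm
      refine LinearMap.ext fun x => ?_
      simp only [Module.End.mul_apply, hf]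
      rw [leibniz_lie, T.h_abelian _ (T.h₀_le_h a'.2) _ (T.h₀_le_h a.2), zero_lie, zero_add])
  have h2 := h1.comp (f := fun α : T.posRoots => (⇑(α.1 : Module.Dual k T.h₀) : T.h₀ → k))
    fun α β h => Subtype.ext (DFunLike.coe_injective h)
  refine h2.mono fun α x hx => ?_
  simp only [Function.comp_apply, Submodule.mem_iInf]
  intro a
  have : x ∈ (f a).eigenspace (α.1 a) := Module.End.mem_eigenspace_iff.2 (hx a)
  exact Module.End.genEigenspace_le_maximal _ _ _ this

variable {J : T.posRoots → Type*}

open Classical in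
/-- The basis of `𝔤₊` assembled from bases of the root spaces. -/
noncomputable def posBasis [CharZero k]
    (c : ∀ α : T.posRoots, Module.Basis (J α) k (T.rootSpace α.1)) :
    Module.Basis (Σ α, J α) k T.pos.toSubmodule :=
  (DFinsupp.basis c).map
    ((LinearEquiv.ofInjective _ iSupIndep_rootSpace.dfinsupp_lsum_injective).trans
      (LinearEquiv.ofEq _ _
        ((Submodule.iSup_eq_range_dfinsupp_lsum _).symm.trans iSup_rootSpace)))

theorem posBasis_apply [CharZero k]
    (c : ∀ α : T.posRoots, Module.Basis (J α) k (T.rootSpace α.1)) (j : Σ α, J α) :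
    (posBasis c j : g) = c j.1 j.2 := by
  classical
  have h : DFinsupp.basis c j = DFinsupp.single j.1 (c j.1 j.2) := by
    rw [Module.Basis.apply_eq_iff]
    change (sigmaFinsuppLequivDFinsupp k).symm (DFinsupp.mapRange.linearEquiv
      (fun i => (c i).repr) (DFinsupp.single j.1 (c j.1 j.2))) = _
    rw [LinearEquiv.symm_apply_eq, DFinsupp.mapRange.linearEquiv_apply, DFinsupp.mapRange_single,
      Module.Basis.repr_self]
    exact (sigmaFinsuppEquivDFinsupp_single j 1).symm
  rw [posBasis, Module.Basis.map_apply, h]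
  simp

end TriangularDecomposition

/-! ### Adapted bases of the truncated current algebra -/

namespace TruncatedPoly

variable (k : Type*) [Field k] (N : ℕ)

/-- The basis `1, t, …, t ^ N` of `k[t] / t^(N+1) k[t]`. -/
noncomputable def tBasis : Module.Basis (Fin (N + 1)) k (TruncatedPoly k N) :=
  ((AdjoinRoot.powerBasis' (Polynomial.monic_X_pow (R := k) (N + 1))).basis.reindex
    (finCongr (by simp))).map
      { toFun := fun x => x
        map_add' := fun _ _ => rfl
        map_smul' := fun _ _ => rfl
        invFun := fun x => x }

theorem tBasis_apply (i : Fin (N + 1)) : tBasis k N i = tPow k N i := by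
  rw [tBasis, Module.Basis.map_apply, Module.Basis.reindex_apply, PowerBasis.basis_eq_pow, tPow]
  rfl

theorem tPow_mul (m n : ℕ) : tPow k N m * tPow k N n = tPow k N (m + n) := by
  rw [tPow, tPow, tPow, ← map_mul, ← pow_add]

theorem tPow_eq_zero {d : ℕ} (h : N < d) : tPow k N d = 0 := by
  rw [tPow, Ideal.Quotient.eq_zero_iff_mem, Ideal.mem_span_singleton]
  exact pow_dvd_pow _ h

theorem tPow_zero : tPow k N 0 = 1 := by
  rw [tPow, pow_zero, map_one]

theorem tBasis_repr_tPow {d : ℕ} {i : Fin (N + 1)} (h : (tBasis k N).repr (tPow k N d) i ≠ 0) :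
    (i : ℕ) = d := by
  by_cases hd : N < d
  · simp [tPow_eq_zero k N hd] at h
  · rw [show tPow k N d = tBasis k N ⟨d, by omega⟩ from (tBasis_apply k N ⟨d, by omega⟩).symm,
      Module.Basis.repr_self, Finsupp.single_apply] at h
    by_contra hne
    exact h (if_neg fun h' => hne (by rw [← h']))

end TruncatedPoly

namespace TriangularDecomposition

open TruncatedPoly InducedModule

variable {k g : Type*} [Field k] [LieRing g] [LieAlgebra k g] {T : TriangularDecomposition k g}
  {J : T.posRoots → Type*}

/-- The index set of a basis of `𝔤₋ ⊗ k[t] / t^(N+1) k[t]`: a power of `t` and an index of a basis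
of `𝔤₊`. It carries an arbitrary linear order. -/
def NegIndex (N : ℕ) (J : T.posRoots → Type*) : Type _ := Fin (N + 1) × Σ α, J α

open Classical in
noncomputable instance (N : ℕ) : LinearOrder (NegIndex N J) := linearOrderOfSTO WellOrderingRel

variable (T) in
/-- The index set of a basis of `(𝔥 ⊕ 𝔤₊) ⊗ k[t] / t^(N+1) k[t]`. -/
abbrev BorelIndex (N : ℕ) (J : T.posRoots → Type*) : Type _ :=
  Fin (N + 1) × (Module.Basis.ofVectorSpaceIndex k T.h.toSubmodule ⊕ Σ α, J α)

section Bases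

variable [CharZero k] (c c' : ∀ α : T.posRoots, Module.Basis (J α) k (T.rootSpace α.1))

/-- A basis of `𝔤` adapted to the triangular decomposition, with independent choices for the bases
of `𝔤₋` and `𝔤₊`. -/
noncomputable def gBasis :
    Module.Basis ((Σ α, J α) ⊕ (Module.Basis.ofVectorSpaceIndex k T.h.toSubmodule ⊕ Σ α, J α))
      k g :=
  ((posBasis c).prod ((Module.Basis.ofVectorSpace k _).prod (posBasis c'))).map T.sumEquiv

variable (N : ℕ) (σ : Fin (N + 1) ≃ Fin (N + 1))

variable (J) in
/-- The powers of `t` distributed over the three parts of an adapted basis of `𝔤`. -/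
def indexEquiv : Fin (N + 1) × ((Σ α, J α) ⊕
    (Module.Basis.ofVectorSpaceIndex k T.h.toSubmodule ⊕ Σ α, J α)) ≃
      NegIndex N J ⊕ BorelIndex T N J :=
  Equiv.prodSumDistrib (Fin (N + 1)) (Σ α, J α) _

/-- The basis of the truncated current algebra attached to bases of the root spaces and to an
enumeration `σ` of the powers of `t`. -/
noncomputable def hatBasis :
    Module.Basis (NegIndex N J ⊕ BorelIndex T N J) k (TruncatedCurrent k g N) :=
  (((tBasis k N).reindex σ.symm).tensorProduct (gBasis c c')).reindex
    (indexEquiv J N)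

theorem hatBasis_inl (p : NegIndex N J) :
    hatBasis c c' N σ (Sum.inl p) = tPow k N (σ p.1) ⊗ₜ T.ω (c p.2.1 p.2.2 : g) := by
  rw [hatBasis, Module.Basis.reindex_apply]
  change ((tBasis k N).reindex σ.symm).tensorProduct (gBasis c c') (p.1, Sum.inl p.2) = _
  rw [Module.Basis.tensorProduct_apply, Module.Basis.reindex_apply, tBasis_apply]
  simp [gBasis, sumEquiv_apply, posBasis_apply]

theorem hatBasis_inr_inl (m : Fin (N + 1)) (i) :
    hatBasis c c' N σ (Sum.inr (m, Sum.inl i)) =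
      tPow k N (σ m) ⊗ₜ (Module.Basis.ofVectorSpace k T.h.toSubmodule i : g) := by
  rw [hatBasis, Module.Basis.reindex_apply]
  change ((tBasis k N).reindex σ.symm).tensorProduct (gBasis c c') (m, Sum.inr (Sum.inl i)) = _
  rw [Module.Basis.tensorProduct_apply, Module.Basis.reindex_apply, tBasis_apply]
  simp [gBasis, sumEquiv_apply]

theorem hatBasis_inr_inr (m : Fin (N + 1)) (j : Σ α, J α) :
    hatBasis c c' N σ (Sum.inr (m, Sum.inr j)) = tPow k N (σ m) ⊗ₜ (c' j.1 j.2 : g) := by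
  rw [hatBasis, Module.Basis.reindex_apply]
  change ((tBasis k N).reindex σ.symm).tensorProduct (gBasis c c') (m, Sum.inr (Sum.inr j)) = _
  rw [Module.Basis.tensorProduct_apply, Module.Basis.reindex_apply, tBasis_apply]
  simp [gBasis, sumEquiv_apply, posBasis_apply]

/-- The power of `t` in a basis vector, for the increasing enumeration of the powers of `t`. -/
def tExp (l : NegIndex N J ⊕ BorelIndex T N J) : Fin (N + 1) := l.elim Prod.fst Prod.fst

omit [CharZero k] in
theorem tExp_inl (p : NegIndex N J) : tExp N (Sum.inl p : NegIndex N J ⊕ BorelIndex T N J) = p.1 :=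
  rfl

omit [CharZero k] in
theorem tExp_inr (p : BorelIndex T N J) : tExp N (Sum.inr p : NegIndex N J ⊕ _) = p.1 :=
  rfl

theorem tExp_of_repr_ne_zero {d : ℕ} {x : g} {l : NegIndex N J ⊕ BorelIndex T N J}
    (h : (hatBasis c c' N (Equiv.refl _)).repr (tPow k N d ⊗ₜ x) l ≠ 0) :
    (tExp N l : ℕ) = d := by
  rw [hatBasis, Module.Basis.repr_reindex_apply] at h
  rcases l with l | l
  · change (((tBasis k N).reindex (Equiv.refl _)).tensorProduct (gBasis c c')).repr _
      (l.1, Sum.inl l.2) ≠ 0 at h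
    rw [Module.Basis.tensorProduct_repr_tmul_apply] at h
    exact tBasis_repr_tPow k N (i := l.1) (by simpa using right_ne_zero_of_mul h)
  · change (((tBasis k N).reindex (Equiv.refl _)).tensorProduct (gBasis c c')).repr _
      (l.1, Sum.inr l.2) ≠ 0 at h
    rw [Module.Basis.tensorProduct_repr_tmul_apply] at h
    exact tBasis_repr_tPow k N (i := l.1) (by simpa using right_ne_zero_of_mul h)

theorem mem_pos_basis (j : Σ α, J α) : (c j.1 j.2 : g) ∈ T.pos :=
  rootSpace_le_pos j.1.2 (c j.1 j.2).2

theorem tmul_mem_span_of_mem_pos (a : TruncatedPoly k N) {x : g} (hx : x ∈ T.pos) :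
    a ⊗ₜ[k] x ∈ Submodule.span k (Set.range fun l => hatBasis c c' N σ (Sum.inr l)) := by
  lift x to T.pos.toSubmodule using hx
  induction a using ((tBasis k N).reindex σ.symm).induction_on' with
  | zero => simp
  | add a b ha hb => rw [TensorProduct.add_tmul]; exact add_mem ha hb
  | smul r a ha => rw [← TensorProduct.smul_tmul']; exact Submodule.smul_mem _ _ ha
  | basis m =>
    induction x using (posBasis c').induction_on' with
    | zero => simp
    | add x y hx hy =>
      rw [Submodule.coe_add, TensorProduct.tmul_add]; exact add_mem hx hy
    | smul r x hx =>
      rw [Submodule.coe_smul, TensorProduct.tmul_smul]; exact Submodule.smul_mem _ _ hx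
    | basis j =>
      refine Submodule.subset_span ⟨(m, Sum.inr j), ?_⟩
      dsimp only
      rw [hatBasis_inr_inr, posBasis_apply, Module.Basis.reindex_apply, tBasis_apply]
      rfl

theorem tmul_mem_span_of_mem_h (a : TruncatedPoly k N) {x : g} (hx : x ∈ T.h) :
    a ⊗ₜ[k] x ∈ Submodule.span k (Set.range fun l => hatBasis c c' N σ (Sum.inr l)) := by
  lift x to T.h.toSubmodule using hx
  induction a using ((tBasis k N).reindex σ.symm).induction_on' with
  | zero => simp
  | add a b ha hb => rw [TensorProduct.add_tmul]; exact add_mem ha hb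
  | smul r a ha => rw [← TensorProduct.smul_tmul']; exact Submodule.smul_mem _ _ ha
  | basis m =>
    induction x using (Module.Basis.ofVectorSpace k T.h.toSubmodule).induction_on' with
    | zero => simp
    | add x y hx hy =>
      rw [Submodule.coe_add, TensorProduct.tmul_add]; exact add_mem hx hy
    | smul r x hx =>
      rw [Submodule.coe_smul, TensorProduct.tmul_smul]; exact Submodule.smul_mem _ _ hx
    | basis j =>
      refine Submodule.subset_span ⟨(m, Sum.inl j), ?_⟩
      dsimp only
      rw [hatBasis_inr_inl, Module.Basis.reindex_apply, tBasis_apply]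
      rfl

theorem hatBasis_inr_cases (l : BorelIndex T N J) :
    ∃ (m : Fin (N + 1)) (x : g), hatBasis c c' N σ (Sum.inr l) = tPow k N (σ m) ⊗ₜ x ∧
      (x ∈ T.h ∨ x ∈ T.pos) := by
  rcases l with ⟨m, i | j⟩
  · exact ⟨m, _, hatBasis_inr_inl c c' N σ m i, Or.inl (Subtype.prop _)⟩
  · exact ⟨m, _, hatBasis_inr_inr c c' N σ m j, Or.inr (mem_pos_basis c' j)⟩

end Bases

/-- `𝔥` normalizes `𝔤₊`. -/
theorem lie_mem_pos_of_mem_h [CharZero k] {y : g} (hy : y ∈ T.h) {x : g} (hx : x ∈ T.pos) :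
    ⁅y, x⁆ ∈ T.pos := by
  have : T.pos.toSubmodule ≤ T.pos.toSubmodule.comap (LieAlgebra.ad k g y : g →ₗ[k] g) := by
    rw [← iSup_rootSpace]
    refine iSup_le fun α x hx => ?_
    refine (le_iSup (fun α : T.posRoots => T.rootSpace α.1) α) fun a => ?_
    rw [LieAlgebra.ad_apply, leibniz_lie, T.h_abelian _ (T.h₀_le_h a.2) _ hy, zero_lie, zero_add,
      hx a, lie_smul]
  exact this hx

/-! ### The highest weight as a functional on the truncated current algebra -/

/-- The extension by zero of a functional on `ĥ`. -/
noncomputable def extendFunctional (N : ℕ) (Λ : Module.Dual k (T.hHat N)) :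
    TruncatedCurrent k g N →ₗ[k] k :=
  Λ ∘ₗ LinearMap.codRestrict (T.hHat N)
    (LinearMap.lTensor (TruncatedPoly k N) (T.h.toSubmodule.subtype ∘ₗ T.hProj)) (by
      intro z
      induction z using TensorProduct.induction_on with
      | zero => simp
      | tmul a x => exact Submodule.subset_span ⟨a, _, (T.hProj x).2, rfl⟩
      | add x y hx hy => rw [map_add]; exact add_mem hx hy)

variable {N : ℕ} (Λ : Module.Dual k (T.hHat N))

theorem extendFunctional_tmul_eq_zero (a : TruncatedPoly k N) {x : g} (hx : T.hProj x = 0) :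
    extendFunctional N Λ (a ⊗ₜ x) = 0 := by
  rw [extendFunctional, LinearMap.comp_apply, ← map_zero Λ]
  congr 1
  exact Subtype.ext (by simp [hx])

theorem extendFunctional_of_mem (z : T.hHat N) : extendFunctional N Λ z = Λ z := by
  rw [extendFunctional, LinearMap.comp_apply]
  congr 1
  refine Subtype.ext ?_
  obtain ⟨z, hz⟩ := z
  rw [LinearMap.codRestrict_apply]
  dsimp only
  induction hz using Submodule.span_induction with
  | mem z hz =>
    obtain ⟨a, x, hx, rfl⟩ := hz
    rw [LinearMap.lTensor_tmul, LinearMap.comp_apply, hProj_of_mem_h hx]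
    rfl
  | zero => simp
  | add x y _ _ hx hy => rw [map_add, hx, hy]
  | smul r x _ hx => rw [map_smul, hx]

theorem extendFunctional_of_mem_hat_pos {z : TruncatedCurrent k g N}
    (hz : z ∈ TruncatedCurrent.hat N T.pos.toSubmodule) : extendFunctional N Λ z = 0 := by
  induction hz using Submodule.span_induction with
  | mem z hz =>
    obtain ⟨a, x, hx, rfl⟩ := hz
    exact extendFunctional_tmul_eq_zero Λ a (hProj_of_mem_pos hx)
  | zero => simp
  | add x y _ _ hx hy => rw [map_add, hx, hy, add_zero]
  | smul r x _ hx => rw [map_smul, hx, smul_zero]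

section Verification

variable [CharZero k] (c c' : ∀ α : T.posRoots, Module.Basis (J α) k (T.rootSpace α.1))

theorem isCharacterDatum (σ : Fin (N + 1) ≃ Fin (N + 1)) :
    IsCharacterDatum (k := k) (L := TruncatedCurrent k g N) (hatBasis c c' N σ)
      (extendFunctional N Λ) := by
  have key : ∀ i j : BorelIndex T N J, ∃ (a : TruncatedPoly k N) (x : g), x ∈ T.pos ∧
      ⁅hatBasis c c' N σ (Sum.inr i), hatBasis c c' N σ (Sum.inr j)⁆ = a ⊗ₜ x := by
    intro i j
    obtain ⟨m, x, hx, hx'⟩ := hatBasis_inr_cases c c' N σ i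
    obtain ⟨n, y, hy, hy'⟩ := hatBasis_inr_cases c c' N σ j
    rw [hx, hy, LieAlgebra.ExtendScalars.bracket_tmul]
    refine ⟨_, _, ?_, rfl⟩
    rcases hx' with hx' | hx' <;> rcases hy' with hy' | hy'
    · rw [T.h_abelian _ hx' _ hy']
      exact zero_mem _
    · exact lie_mem_pos_of_mem_h hx' hy'
    · rw [← lie_skew]
      exact neg_mem (lie_mem_pos_of_mem_h hy' hx')
    · exact T.pos.lie_mem hx' hy'
  refine ⟨fun i => ?_, fun i j => ?_, fun i j => ?_⟩
  · rw [hatBasis_inl]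
    exact extendFunctional_tmul_eq_zero Λ _ (hProj_ω_of_mem_pos (mem_pos_basis c i.2))
  · obtain ⟨a, x, hx, h⟩ := key i j
    rw [h]
    exact tmul_mem_span_of_mem_pos c c' N σ a hx
  · obtain ⟨a, x, hx, h⟩ := key i j
    rw [h]
    exact extendFunctional_tmul_eq_zero Λ _ (hProj_of_mem_pos hx)

/-- The degree of the basis vectors of the truncated current algebra: `2m + 1 - 2N` on
`𝔤₋ ⊗ t^m`, `2m - 2N` on `𝔥 ⊗ t^m` and `2m - 1` on `𝔤₊ ⊗ t^m`. -/
def hatDeg (N : ℕ) : NegIndex N J ⊕ BorelIndex T N J → ℤ :=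
  Sum.elim (fun p => 2 * p.1.val + 1 - 2 * N)
    fun p => 2 * p.1.val + p.2.elim (fun _ => -(2 * N : ℤ)) fun _ => -1

omit [CharZero k] in
theorem hatDeg_inl (p : NegIndex N J) :
    hatDeg N (Sum.inl p : NegIndex N J ⊕ BorelIndex T N J) = 2 * p.1.val + 1 - 2 * N :=
  rfl

omit [CharZero k] in
theorem hatDeg_inr_inl (m : Fin (N + 1)) (i) :
    hatDeg N (Sum.inr (m, Sum.inl i) : NegIndex N J ⊕ BorelIndex T N J) = 2 * m.val + -(2 * N) :=
  rfl

omit [CharZero k] in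
theorem hatDeg_inr_inr (m : Fin (N + 1)) (j) :
    hatDeg N (Sum.inr (m, Sum.inr j) : NegIndex N J ⊕ BorelIndex T N J) = 2 * m.val + -1 :=
  rfl

/-- The pairing `Λ ⁅𝔤₊ ⊗ t^m, 𝔤₋ ⊗ t^l⁆` vanishes for `m + l > N`, that is, when the sum of the
degrees is positive. -/
theorem isHeisenbergDegree (hN : 0 < N) :
    IsHeisenbergDegree (k := k) (L := TruncatedCurrent k g N) (hatBasis c c' N (Equiv.refl _))
      (extendFunctional N Λ) (hatDeg N) := by
  have hneg : ∀ i j : NegIndex N J, extendFunctional N Λ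
      ⁅hatBasis c c' N (Equiv.refl _) (Sum.inl i),
        hatBasis c c' N (Equiv.refl _) (Sum.inl j)⁆ = 0 := by
    intro i j
    rw [hatBasis_inl, hatBasis_inl, LieAlgebra.ExtendScalars.bracket_tmul, ← T.ω_lie]
    exact extendFunctional_tmul_eq_zero Λ _
      (hProj_ω_of_mem_pos (T.pos.lie_mem (mem_pos_basis c _) (mem_pos_basis c _)))
  have hcart : ∀ (m : Fin (N + 1)) (i) (j : NegIndex N J), extendFunctional N Λ
      ⁅hatBasis c c' N (Equiv.refl _) (Sum.inr (m, Sum.inl i)),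
        hatBasis c c' N (Equiv.refl _) (Sum.inl j)⁆ = 0 := by
    intro m i j
    rw [hatBasis_inr_inl, hatBasis_inl, LieAlgebra.ExtendScalars.bracket_tmul,
      lie_ω_eq (Subtype.prop _), ← map_neg]
    exact extendFunctional_tmul_eq_zero Λ _ (hProj_ω_of_mem_pos
      (neg_mem (lie_mem_pos_of_mem_h (Subtype.prop _) (mem_pos_basis c _))))
  refine ⟨hneg, fun i hi => ?_, fun i j hij => ?_, fun i j l hl => ?_⟩
  · rcases i with p | ⟨m, i | j⟩
    · exact absurd ((isCharacterDatum Λ c c' (Equiv.refl _)).map_inl p) hi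
    · have := m.2
      rw [hatDeg_inr_inl]
      omega
    · refine absurd ?_ hi
      rw [hatBasis_inr_inr]
      exact extendFunctional_tmul_eq_zero Λ _ (hProj_of_mem_pos (mem_pos_basis c' j))
  · rcases i with p | ⟨m, i | i⟩
    · exact absurd (hneg p j) hij
    · exact absurd (hcart m i j) hij
    · rw [hatBasis_inr_inr, hatBasis_inl, LieAlgebra.ExtendScalars.bracket_tmul, tPow_mul] at hij
      rw [hatDeg_inr_inr, hatDeg_inl]
      by_contra h
      apply hij
      rw [tPow_eq_zero k N (by simp only [Equiv.refl_apply]; omega), TensorProduct.zero_tmul,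
        map_zero]
  · have hexp : ((tExp N l : Fin (N + 1)) : ℕ) =
        (tExp N i : Fin (N + 1)) + (j.1 : Fin (N + 1)) := by
      rw [hatBasis_inl] at hl
      rcases i with p | ⟨m, i | i⟩
      · rw [hatBasis_inl, LieAlgebra.ExtendScalars.bracket_tmul, tPow_mul] at hl
        exact tExp_of_repr_ne_zero c c' N hl
      · rw [hatBasis_inr_inl, LieAlgebra.ExtendScalars.bracket_tmul, tPow_mul] at hl
        exact tExp_of_repr_ne_zero c c' N hl
      · rw [hatBasis_inr_inr, LieAlgebra.ExtendScalars.bracket_tmul, tPow_mul] at hl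
        exact tExp_of_repr_ne_zero c c' N hl
    -- the degree of a bracket is determined by the exponents, and a basis vector of `ĥ` is the only
    -- one whose degree need not exceed the sum of the degrees
    rcases l with l | ⟨n, l | l⟩ <;> rcases i with p | ⟨m, i | i⟩ <;>
      simp only [hatDeg_inl, hatDeg_inr_inl, hatDeg_inr_inr, tExp_inl, tExp_inr] at hexp ⊢
    any_goals (left; omega)
    all_goals exact Or.inr ⟨by omega, _, rfl, hcart n l⟩

/-- The index of the basis vector `x' ⊗ t^(N-m)` dual to `ω(x) ⊗ t^m`. -/
def starIndex (p : NegIndex N J) : BorelIndex T N J := (Fin.rev p.1, Sum.inr p.2)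

/-- The basis `c'` is dual to `c` for the non-degenerate pairing. -/
def IsDualPair (P : T.NondegeneratePairing) : Prop :=
  ∀ (α : T.posRoots) (i j : J α), ⁅(c' α i : g), T.ω (c α j : g)⁆ =
    open Classical in (if i = j then (1 : k) else 0) • (P.hElt ⟨α.1, Or.inl α.2⟩ : g)

variable {c c'} {P : T.NondegeneratePairing}

theorem map_lie_star_self (h : IsDualPair c c' P) (p : NegIndex N J) :
    extendFunctional N Λ ⁅hatBasis c c' N (Equiv.refl _) (Sum.inr (starIndex p)),
      hatBasis c c' N (Equiv.refl _) (Sum.inl p)⁆ =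
        Λ (TruncatedCurrent.hatElt N (P.hElt ⟨p.2.1.1, Or.inl p.2.1.2⟩) N) := by
  rw [starIndex, hatBasis_inr_inr, hatBasis_inl, LieAlgebra.ExtendScalars.bracket_tmul, tPow_mul,
    h, if_pos rfl, one_smul, ← extendFunctional_of_mem]
  have : ((Fin.rev p.1 : Fin (N + 1)) : ℕ) + p.1 = N := by
    rw [Fin.val_rev]
    omega
  simp only [Equiv.refl_apply, this]
  rfl

theorem isDualFamily (h : IsDualPair c c' P) :
    IsDualFamily (k := k) (L := TruncatedCurrent k g N) (hatBasis c c' N (Equiv.refl _))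
      (extendFunctional N Λ) (hatDeg N)
      (starIndex (J := J)) := by
  refine ⟨fun p => ?_, fun p => ?_, fun p q hqp hne => ?_⟩
  · rw [starIndex, hatDeg_inr_inr, hatDeg_inl, Fin.val_rev]
    have := p.1.2
    omega
  · rw [starIndex, hatBasis_inr_inr]
    exact extendFunctional_tmul_eq_zero Λ _ (hProj_of_mem_pos (mem_pos_basis c' _))
  · rw [starIndex, hatBasis_inr_inr, hatBasis_inl, LieAlgebra.ExtendScalars.bracket_tmul,
      tPow_mul] at hne
    obtain ⟨m, α, i⟩ := p
    obtain ⟨n, β, j⟩ := q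
    dsimp only at hne
    have h1 : ((Fin.rev m : Fin (N + 1)) : ℕ) + n ≤ N := by
      by_contra hlt
      rw [tPow_eq_zero k N (by simpa using hlt), TensorProduct.zero_tmul, map_zero] at hne
      exact hne rfl
    rw [Fin.val_rev] at h1
    have hnm : n ≠ m := by
      rintro rfl
      apply hne
      by_cases hαβ : α = β
      · subst hαβ
        have hij : i ≠ j := by
          rintro rfl
          exact hqp rfl
        rw [h, if_neg hij, zero_smul, TensorProduct.tmul_zero, map_zero]
      · -- brackets of root vectors for distinct roots have no component in `𝔥`
        refine extendFunctional_tmul_eq_zero Λ _ (hProj_of_mem_rootSpace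
          (γ := α.1 - β.1) (sub_ne_zero.2 fun h => hαβ (Subtype.ext h)) fun a => ?_)
        rw [leibniz_lie, (c' α i).2 a, lie_ω_eq (T.h₀_le_h a.2), (c β j).2 a, map_smul, smul_lie,
          lie_neg, lie_smul, LinearMap.sub_apply, sub_smul, sub_eq_add_neg]
    change (2 * (n : ℕ) + 1 - 2 * N : ℤ) < 2 * (m : ℕ) + 1 - 2 * N
    have : (n : ℕ) ≠ m := fun h => hnm (Fin.ext h)
    have := m.2
    omega

/-- The weight of a basis vector of `ĝ₋`, with the opposite sign. -/
def negWt (p : NegIndex N J) : Module.Dual k T.h₀ := p.2.1.1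

omit [CharZero k] in
theorem negWt_mem (p : NegIndex N J) : negWt p ∈ T.posRoots := p.2.1.2

/-- The embedding of `𝔥₀` into the truncated current algebra. -/
noncomputable def torusMap (N : ℕ) (a : T.h₀) : TruncatedCurrent k g N := tPow k N 0 ⊗ₜ (a : g)

omit [CharZero k] in
theorem lie_torusMap_ω {α : Module.Dual k T.h₀} (a : T.h₀) (r : TruncatedPoly k N) {x : g}
    (hx : x ∈ T.rootSpace α) : ⁅torusMap N a, r ⊗ₜ[k] T.ω x⁆ = -(α a) • r ⊗ₜ[k] T.ω x := by
  rw [torusMap, LieAlgebra.ExtendScalars.bracket_tmul, tPow_zero, one_mul,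
    lie_ω_eq (T.h₀_le_h a.2), hx a, map_smul, ← neg_smul, TensorProduct.tmul_smul]

variable (c c') in
theorem isTorus (σ : Fin (N + 1) ≃ Fin (N + 1)) :
    IsTorus (k := k) (L := TruncatedCurrent k g N) (hatBasis c c' N σ) (torusMap N) negWt := by
  refine ⟨fun a => tmul_mem_span_of_mem_h c c' N σ _ (T.h₀_le_h a.2), fun a i => ?_,
    eq_zero_of_wtM_eq_zero negWt_mem⟩
  rw [hatBasis_inl]
  exact lie_torusMap_ω a _ (c i.2.1 i.2.2).2

omit [CharZero k] in
theorem lTensor_ω_lie (x y : TruncatedCurrent k g N) :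
    LinearMap.lTensor (TruncatedPoly k N) T.ω ⁅x, y⁆ =
      ⁅LinearMap.lTensor (TruncatedPoly k N) T.ω y,
        LinearMap.lTensor (TruncatedPoly k N) T.ω x⁆ := by
  have hadd : ∀ x x' y : TruncatedCurrent k g N, ⁅x + x', y⁆ = ⁅x, y⁆ + ⁅x', y⁆ :=
    add_lie (L := TruncatedCurrent k g N) (M := TruncatedCurrent k g N)
  have hadd' : ∀ x y y' : TruncatedCurrent k g N, ⁅x, y + y'⁆ = ⁅x, y⁆ + ⁅x, y'⁆ :=
    lie_add (L := TruncatedCurrent k g N) (M := TruncatedCurrent k g N)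
  have hzero : ∀ y : TruncatedCurrent k g N, ⁅(0 : TruncatedCurrent k g N), y⁆ = 0 :=
    zero_lie (L := TruncatedCurrent k g N) (M := TruncatedCurrent k g N)
  have hzero' : ∀ y : TruncatedCurrent k g N, ⁅y, (0 : TruncatedCurrent k g N)⁆ = 0 :=
    lie_zero (L := TruncatedCurrent k g N) (M := TruncatedCurrent k g N)
  induction x using TensorProduct.induction_on with
  | zero => rw [hzero, map_zero, hzero']
  | add x x' hx hx' => rw [hadd, map_add, hx, hx', map_add, hadd']
  | tmul r x =>
    induction y using TensorProduct.induction_on with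
    | zero => rw [hzero', map_zero, hzero]
    | add y y' hy hy' => rw [hadd', map_add, hy, hy', map_add, hadd]
    | tmul s y =>
      rw [LieAlgebra.ExtendScalars.bracket_tmul, LinearMap.lTensor_tmul, LinearMap.lTensor_tmul,
        LinearMap.lTensor_tmul, LieAlgebra.ExtendScalars.bracket_tmul, T.ω_lie, mul_comm]

variable (c c') in
/-- The second basis has the roles of `c` and `c'` exchanged and the powers of `t` enumerated in
reverse, so that `ω` maps its vector `ω(x') ⊗ t^(N-m)` to the basis vector dual to
`ω(x) ⊗ t^m`. -/
theorem isContravariant : IsContravariant (k := k) (L := TruncatedCurrent k g N)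
    (hatBasis c c' N (Equiv.refl _)) (extendFunctional N Λ)
    (torusMap N) negWt (hatBasis c' c N Fin.revPerm) (LinearMap.lTensor _ T.ω) starIndex := by
  refine ⟨isCharacterDatum Λ c' c _, fun x y => ?_, fun x => ?_, fun p => ?_, fun a p => ?_,
    fun l => ?_⟩
  · exact lTensor_ω_lie x y
  · rw [← LinearMap.comp_apply, ← LinearMap.lTensor_comp,
      show T.ω ∘ₗ T.ω = LinearMap.id from LinearMap.ext T.ω_ω, LinearMap.lTensor_id,
      LinearMap.id_apply]
  · rw [hatBasis_inl, LinearMap.lTensor_tmul, T.ω_ω, starIndex, hatBasis_inr_inr]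
    rfl
  · rw [starIndex, hatBasis_inr_inr, torusMap, LieAlgebra.ExtendScalars.bracket_tmul, tPow_zero,
      one_mul, (c' p.2.1 p.2.2).2 a, TensorProduct.tmul_smul]
    rfl
  · rcases l with ⟨m, i | j⟩
    · right
      refine ⟨?_, fun a => ?_, ?_⟩ <;> rw [hatBasis_inr_inl]
      · rw [LinearMap.lTensor_tmul, T.ω_h _ (Subtype.prop _)]
      · rw [torusMap, LieAlgebra.ExtendScalars.bracket_tmul,
          T.h_abelian _ (T.h₀_le_h a.2) _ (Subtype.prop _), TensorProduct.tmul_zero]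
      · exact tmul_mem_span_of_mem_h c c' N _ _ (Subtype.prop _)
    · left
      refine ⟨?_, (m, j), fun a => ?_⟩ <;> rw [hatBasis_inr_inr]
      · exact extendFunctional_tmul_eq_zero Λ _ (hProj_of_mem_pos (mem_pos_basis c j))
      · rw [LinearMap.lTensor_tmul]
        exact lie_torusMap_ω a _ (c j.1 j.2).2

end Verification

end TriangularDecomposition

/-! ### Proper submodules and primitive vectors of the Verma module -/

namespace TriangularDecomposition

open TruncatedPoly InducedModule

variable {k g : Type*} [Field k] [CharZero k] [LieRing g] [LieAlgebra k g]
  {T : TriangularDecomposition k g} {J : T.posRoots → Type*} {N : ℕ} {Λ : Module.Dual k (T.hHat N)}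
  {c c' : ∀ α : T.posRoots, Module.Basis (J α) k (T.rootSpace α.1)}

variable (c c' Λ) in
/-- The action of the enveloping algebra on the monomial model of the Verma module. -/
noncomputable abbrev modelRep :
    UniversalEnvelopingAlgebra k (TruncatedCurrent k g N) →ₐ[k]
      Module.End k (Multiset (NegIndex N J) →₀ k) :=
  envRep (k := k) (L := TruncatedCurrent k g N) (hatBasis c c' N (Equiv.refl _))
    (extendFunctional N Λ) (isCharacterDatum Λ c c' _)

variable (c c' Λ) in
/-- The Verma module is isomorphic to its monomial model. -/
theorem exists_modelEquiv : ∃ e : T.CurrentVerma N Λ ≃ₗ[k] (Multiset (NegIndex N J) →₀ k),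
    ∀ u m, e (u • m) = modelRep Λ c c' u (e m) := by
  refine exists_vermaEquiv _ (fun x hx => ⟨?_, extendFunctional_of_mem_hat_pos Λ hx⟩)
    (fun x => ⟨?_, extendFunctional_of_mem Λ x⟩) fun l => ?_
  · induction hx using Submodule.span_induction with
    | mem z hz =>
      obtain ⟨a, x, hx, rfl⟩ := hz
      exact tmul_mem_span_of_mem_pos c c' N _ a hx
    | zero => exact zero_mem _
    | add x y _ _ hx hy => exact add_mem hx hy
    | smul r x _ hx => exact Submodule.smul_mem _ _ hx
  · obtain ⟨x, hx⟩ := x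
    dsimp only
    induction hx using Submodule.span_induction with
    | mem z hz =>
      obtain ⟨a, x, hx, rfl⟩ := hz
      exact tmul_mem_span_of_mem_h c c' N _ a hx
    | zero => exact zero_mem _
    | add x y _ _ hx hy => exact add_mem hx hy
    | smul r x _ hx => exact Submodule.smul_mem _ _ hx
  · obtain ⟨m, x, h, hx | hx⟩ := hatBasis_inr_cases c c' N (Equiv.refl _) l
    · exact Or.inr (h ▸ Submodule.subset_span ⟨_, _, hx, rfl⟩)
    · exact Or.inl (h ▸ Submodule.subset_span ⟨_, _, hx, rfl⟩)

variable {e : T.CurrentVerma N Λ ≃ₗ[k] (Multiset (NegIndex N J) →₀ k)}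

/-- On a proper submodule the coefficient of the highest weight vector vanishes. -/
theorem modelRep_apply_zero_of_ne_top (he : ∀ u m, e (u • m) = modelRep Λ c c' u (e m))
    {W : Submodule (UniversalEnvelopingAlgebra k (TruncatedCurrent k g N)) (T.CurrentVerma N Λ)}
    (hW : W ≠ ⊤) {w : T.CurrentVerma N Λ} (hw : w ∈ W)
    (u : UniversalEnvelopingAlgebra k (TruncatedCurrent k g N)) :
    modelRep Λ c c' u (e w) 0 = 0 := by
  by_contra h0
  rw [← he] at h0
  have hmem : mono k 0 ∈ (W.restrictScalars k).map e.toLinearMap := by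
    refine mono_zero_mem_of_apply_zero_ne_zero (k := k) (L := TruncatedCurrent k g N)
      (isCharacterDatum Λ c c' (Equiv.refl _)) (isTorus c c' (Equiv.refl _)) _ ?_
      ⟨u • w, W.smul_mem u hw, rfl⟩ h0
    rintro a _ ⟨m, hm, rfl⟩
    refine ⟨UniversalEnvelopingAlgebra.ι k (torusMap N a) • m, W.smul_mem _ hm, ?_⟩
    exact (he _ _).trans (by rw [modelRep, envRep_ι]; rfl)
  obtain ⟨w₀, hw₀, hw₀'⟩ := hmem
  refine hW (eq_top_iff.2 fun m _ => ?_)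
  obtain ⟨u', hu'⟩ := exists_envRep_mono_zero (k := k) (L := TruncatedCurrent k g N)
    (isCharacterDatum Λ c c' (Equiv.refl _)) (e m)
  have : m = u' • w₀ := by
    apply e.injective
    rw [he, ← hu', ← hw₀']
    rfl
  rw [this]
  exact W.smul_mem _ hw₀

theorem span_ne_top_of_modelRep_apply_zero (he : ∀ u m, e (u • m) = modelRep Λ c c' u (e m))
    {v : T.CurrentVerma N Λ} (hv : ∀ u, modelRep Λ c c' u (e v) 0 = 0) :
    Submodule.span (UniversalEnvelopingAlgebra k (TruncatedCurrent k g N)) {v} ≠ ⊤ := by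
  intro h
  have : e.symm (mono k 0) ∈
      Submodule.span (UniversalEnvelopingAlgebra k (TruncatedCurrent k g N)) {v} :=
    h ▸ Submodule.mem_top
  obtain ⟨u, hu⟩ := Submodule.mem_span_singleton.1 this
  have h1 := hv u
  rw [← he, hu, LinearEquiv.apply_symm_apply] at h1
  simp at h1

theorem memWeightSpace_iff (he : ∀ u m, e (u • m) = modelRep Λ c c' u (e m))
    (χ : Module.Dual k T.h₀) (v : T.CurrentVerma N Λ) :
    T.MemWeightSpace (N := N) (T.restrictWeight N Λ - χ) v ↔ e v ∈ wtSpace k negWt χ := by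
  rw [mem_wtSpace_iff (k := k) (L := TruncatedCurrent k g N)
    (isCharacterDatum Λ c c' (Equiv.refl _)) (isTorus c c' _)]
  refine forall_congr' fun a => ?_
  rw [← e.injective.eq_iff, he, map_smul, envRep_ι]
  have : extendFunctional N Λ (torusMap N a) = T.restrictWeight N Λ a :=
    extendFunctional_of_mem Λ
      (TruncatedCurrent.hatElt N (V := T.h.toSubmodule) ⟨a, T.h₀_le_h a.2⟩ 0)
  rw [this]
  rfl

variable {P : T.NondegeneratePairing}

theorem exists_mem_support_of_span_ne_top (hN : 0 < N) (h : IsDualPair c c' P)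
    (he : ∀ u m, e (u • m) = modelRep Λ c c' u (e m))
    {W : Submodule (UniversalEnvelopingAlgebra k (TruncatedCurrent k g N)) (T.CurrentVerma N Λ)}
    (hW : W ≠ ⊤) {w : T.CurrentVerma N Λ} (hw : w ∈ W) (hw0 : w ≠ 0) :
    ∃ F ∈ (e w).support, ∃ p ∈ F,
      Λ (TruncatedCurrent.hatElt N (P.hElt ⟨p.2.1.1, Or.inl p.2.1.2⟩) N) = 0 := by
  obtain ⟨F, hF, p, hp, hp'⟩ := exists_map_lie_star_eq_zero (k := k) (L := TruncatedCurrent k g N)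
    (isCharacterDatum Λ c c' _) (isHeisenbergDegree Λ c c' hN) (isDualFamily Λ h)
    (isContravariant Λ c c') (p := e w) (by simpa using hw0)
    (modelRep_apply_zero_of_ne_top he hW hw)
  rw [map_lie_star_self Λ h] at hp'
  exact ⟨F, hF, p, hp, hp'⟩

theorem exists_primitive_of_map_eq_zero [∀ α, Finite (J α)] (hN : 0 < N) (h : IsDualPair c c' P)
    (he : ∀ u m, e (u • m) = modelRep Λ c c' u (e m)) {χ : Module.Dual k T.h₀}
    (F : Multiset (NegIndex N J)) (hF : wtM negWt F = χ) {p : NegIndex N J} (hp : p ∈ F)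
    (hΛ : Λ (TruncatedCurrent.hatElt N (P.hElt ⟨p.2.1.1, Or.inl p.2.1.2⟩) N) = 0) :
    ∃ v : T.CurrentVerma N Λ, v ≠ 0 ∧
      T.IsPrimitiveVector (N := N) (T.restrictWeight N Λ - χ) v := by
  have hfin : {M : Multiset (NegIndex N J) | wtM negWt M = χ}.Finite := by
    refine finite_wtM_eq negWt_mem (fun α => ?_) (hF ▸ wtM_mem_posCone negWt_mem F)
    by_cases hα : α ∈ T.posRoots
    · refine (Set.finite_range fun q : Fin (N + 1) × J ⟨α, hα⟩ =>
        ((q.1, ⟨⟨α, hα⟩, q.2⟩) : NegIndex N J)).subset ?_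
      rintro ⟨m, ⟨β, hβ⟩, j⟩ (rfl : β = α)
      exact ⟨(m, j), rfl⟩
    · refine Set.finite_empty.subset ?_
      rintro q (rfl : negWt q = α)
      exact hα (negWt_mem q)
  obtain ⟨x, hx, hx0, hx'⟩ := exists_mem_wtSpace_of_map_lie_star_eq_zero (k := k)
    (L := TruncatedCurrent k g N) (isCharacterDatum Λ c c' _) (isTorus c c' _)
    (isHeisenbergDegree Λ c c' hN) (isDualFamily Λ h) (isContravariant Λ c c') hfin hF hp
    (by rw [map_lie_star_self Λ h, hΛ])
  refine ⟨e.symm x, by simpa using hx0, ?_, ?_⟩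
  · rw [memWeightSpace_iff he, LinearEquiv.apply_symm_apply]
    exact hx
  · refine span_ne_top_of_modelRep_apply_zero he fun u => ?_
    rw [LinearEquiv.apply_symm_apply]
    exact hx' u

/-! ### Dual bases and opposite roots -/

theorem finite_rootSpace (α : T.posRoots) : Module.Finite k (T.rootSpace α.1) := by
  have := T.pos_finite α.1
  rwa [inf_eq_left.2 (rootSpace_le_pos α.2)] at this

theorem exists_isDualPair (P : T.NondegeneratePairing) : ∃ (n : T.posRoots → ℕ)
    (c c' : ∀ α : T.posRoots, Module.Basis (Fin (n α)) k (T.rootSpace α.1)),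
      IsDualPair c c' P := by
  have := finite_rootSpace (T := T)
  refine ⟨fun α => Module.finrank k (T.rootSpace α.1), fun α => Module.finBasis k _, fun α =>
    (P.form ⟨α.1, Or.inl α.2⟩).dualBasis (P.form_nondegenerate _) (Module.finBasis k _),
    fun α i j => ?_⟩
  rw [P.lie_ω ⟨α.1, Or.inl α.2⟩, LinearMap.BilinForm.apply_dualBasis_left]
  by_cases hij : i = j
  · simp [hij]
  · simp [hij, Ne.symm hij]

omit [CharZero k] in
/-- The elements `h_α` and `h_{-α}` are proportional. -/
theorem map_hElt_neg_eq_zero (P : T.NondegeneratePairing) {α : Module.Dual k T.h₀}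
    (hα : α ∈ T.roots) (hα' : -α ∈ T.posRoots)
    (h : Λ (TruncatedCurrent.hatElt N (P.hElt ⟨α, hα⟩) N) = 0) :
    Λ (TruncatedCurrent.hatElt N (P.hElt ⟨-α, Or.inl hα'⟩) N) = 0 := by
  set β : T.roots := ⟨-α, Or.inl hα'⟩ with hβ
  obtain ⟨x, hx, hx0⟩ := (Submodule.ne_bot_iff _).1 hα'
  obtain ⟨y, hy⟩ : ∃ y, P.form β ⟨x, hx.1⟩ y ≠ 0 := by
    by_contra! h'
    exact hx0 (congrArg Subtype.val ((P.form_nondegenerate β).1 _ h'))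
  have hω : ∀ z ∈ T.rootSpace (-α), T.ω z ∈ T.rootSpace α := by
    intro z hz a
    rw [lie_ω_eq (T.h₀_le_h a.2), hz a, map_smul, LinearMap.neg_apply, neg_smul, neg_neg]
  have e1 := P.lie_ω β ⟨x, hx.1⟩ y
  have e2 := P.lie_ω ⟨α, hα⟩ ⟨T.ω x, hω x hx.1⟩ ⟨T.ω y, hω y y.2⟩
  have e3 := congrArg T.ω e1
  rw [T.ω_lie, map_smul, T.ω_h _ (P.hElt β).2, T.ω_ω] at e3
  dsimp only at e2 e3
  rw [T.ω_ω, ← lie_skew, e3] at e2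
  have e4 : P.form β ⟨x, hx.1⟩ y • P.hElt β =
      -(P.form ⟨α, hα⟩ ⟨T.ω x, hω x hx.1⟩ ⟨T.ω y, hω y y.2⟩) • P.hElt ⟨α, hα⟩ := by
    apply Subtype.ext
    change _ • (P.hElt β : g) = -_ • (P.hElt ⟨α, hα⟩ : g)
    rw [neg_smul, ← e2, neg_neg]
  have hsmul : ∀ (r : k) (z : T.h), Λ (TruncatedCurrent.hatElt N (r • z) N) =
      r * Λ (TruncatedCurrent.hatElt N z N) := by
    intro r z
    rw [← smul_eq_mul, ← map_smul]
    exact congrArg Λ (Subtype.ext (TensorProduct.tmul_smul _ _ _))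
  have e5 := hsmul (P.form β ⟨x, hx.1⟩ y) (P.hElt β)
  rw [e4, hsmul, h, mul_zero] at e5
  exact (mul_eq_zero.1 e5.symm).resolve_left hy

omit [CharZero k] in
theorem exists_negIndex {n : T.posRoots → ℕ}
    (c : ∀ α : T.posRoots, Module.Basis (Fin (n α)) k (T.rootSpace α.1))
    {α : Module.Dual k T.h₀} (hα : α ∈ T.posRoots) :
    ∃ p : NegIndex N fun α => Fin (n α), negWt p = α := by
  have hne : Nonempty (Fin (n ⟨α, hα⟩)) := by
    by_contra hempty
    rw [not_nonempty_iff] at hempty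
    refine hα (eq_bot_iff.2 fun x hx => ?_)
    exact congrArg Subtype.val (((c ⟨α, hα⟩).ext_elem fun i => hempty.elim i :
      (⟨x, hx.1⟩ : T.rootSpace α) = 0))
  exact ⟨(0, ⟨⟨α, hα⟩, hne.some⟩), rfl⟩

omit [CharZero k] in
/-- Every element of `Q₊` is the weight of a monomial. -/
theorem exists_wtM_eq {n : T.posRoots → ℕ}
    (c : ∀ α : T.posRoots, Module.Basis (Fin (n α)) k (T.rootSpace α.1))
    {χ : Module.Dual k T.h₀} (hχ : χ ∈ T.posCone) :
    ∃ F : Multiset (NegIndex N fun α => Fin (n α)), wtM negWt F = χ := by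
  induction hχ using AddSubmonoid.closure_induction with
  | mem α hα =>
    obtain ⟨p, hp⟩ := exists_negIndex c hα
    exact ⟨{p}, by simp [wtM, hp]⟩
  | zero => exact ⟨0, rfl⟩
  | add x y _ _ hx hy =>
    obtain ⟨F, rfl⟩ := hx
    obtain ⟨G, rfl⟩ := hy
    exact ⟨F + G, by simp [wtM]⟩

end TriangularDecomposition

open TriangularDecomposition InducedModule in
theorem mainTheorem1 {k g : Type*} [Field k] [CharZero k] [LieRing g] [LieAlgebra k g]
    (T : TriangularDecomposition k g) (P : T.NondegeneratePairing)
    (N : ℕ) (hN : 0 < N) (Λ : Module.Dual k (T.hHat N)) :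
    (∀ χ ∈ T.posCone,
      ((∃ v : T.CurrentVerma N Λ, v ≠ 0 ∧
          T.IsPrimitiveVector (N := N) (T.restrictWeight N Λ - χ) v) ↔
        ∃ α : T.roots, (α : Module.Dual k T.h₀) ∈ T.posRoots ∧
          χ - (α : Module.Dual k T.h₀) ∈ T.posCone ∧
          Λ (TruncatedCurrent.hatElt N (P.hElt α) N) = 0)) ∧
    (IsReducibleModule (UniversalEnvelopingAlgebra k (TruncatedCurrent k g N))
        (T.CurrentVerma N Λ) ↔
      ∃ α : T.roots, Λ (TruncatedCurrent.hatElt N (P.hElt α) N) = 0) ∧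
    (IsReducibleModule (UniversalEnvelopingAlgebra k (TruncatedCurrent k g N))
        (T.CurrentVerma N Λ) ↔
      ∃ α : T.roots, (α : Module.Dual k T.h₀) ∈ T.posRoots ∧
        Λ (TruncatedCurrent.hatElt N (P.hElt α) N) = 0) := by
  obtain ⟨n, c, c', hcc⟩ := exists_isDualPair P
  obtain ⟨e, he⟩ := exists_modelEquiv Λ c c'
  have part1 : ∀ χ ∈ T.posCone,
      ((∃ v : T.CurrentVerma N Λ, v ≠ 0 ∧
          T.IsPrimitiveVector (N := N) (T.restrictWeight N Λ - χ) v) ↔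
        ∃ α : T.roots, (α : Module.Dual k T.h₀) ∈ T.posRoots ∧
          χ - (α : Module.Dual k T.h₀) ∈ T.posCone ∧
          Λ (TruncatedCurrent.hatElt N (P.hElt α) N) = 0) := by
    intro χ _
    constructor
    · rintro ⟨v, hv0, hv, hspan⟩
      obtain ⟨F, hF, p, hp, hΛ⟩ := exists_mem_support_of_span_ne_top hN hcc he hspan
        (Submodule.mem_span_singleton_self v) hv0
      refine ⟨⟨negWt p, Or.inl (negWt_mem p)⟩, negWt_mem p, ?_, hΛ⟩
      have hFχ : wtM negWt F = χ := (memWeightSpace_iff he χ v).1 hv hF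
      rw [← hFχ, ← Multiset.cons_erase hp, wtM_cons, add_sub_cancel_left]
      exact wtM_mem_posCone negWt_mem _
    · rintro ⟨⟨α, hα'⟩, hα, hχ, hΛ⟩
      obtain ⟨p, hp⟩ := exists_negIndex (N := N) c hα
      obtain ⟨F, hF⟩ := exists_wtM_eq (N := N) c hχ
      refine exists_primitive_of_map_eq_zero hN hcc he (p ::ₘ F)
        (by rw [wtM_cons, hp, hF]; exact add_sub_cancel _ _) (Multiset.mem_cons_self p F) ?_
      subst hp
      exact hΛ
  have part3 : IsReducibleModule (UniversalEnvelopingAlgebra k (TruncatedCurrent k g N))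
        (T.CurrentVerma N Λ) ↔
      ∃ α : T.roots, (α : Module.Dual k T.h₀) ∈ T.posRoots ∧
        Λ (TruncatedCurrent.hatElt N (P.hElt α) N) = 0 := by
    constructor
    · rintro ⟨W, hbot, htop⟩
      obtain ⟨w, hw, hw0⟩ := (Submodule.ne_bot_iff _).1 hbot
      obtain ⟨F, hF, p, hp, hΛ⟩ := exists_mem_support_of_span_ne_top hN hcc he htop hw hw0
      exact ⟨⟨negWt p, Or.inl (negWt_mem p)⟩, negWt_mem p, hΛ⟩
    · rintro ⟨α, hα, hΛ⟩
      obtain ⟨v, hv0, -, hv⟩ := (part1 α (mem_posCone_of_mem_posRoots hα)).2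
        ⟨α, hα, by rw [sub_self]; exact zero_mem _, hΛ⟩
      exact ⟨_, fun h => hv0 (Submodule.span_singleton_eq_bot.1 h), hv⟩
  refine ⟨part1, ?_, part3⟩
  rw [part3]
  constructor
  · rintro ⟨α, -, hΛ⟩
    exact ⟨α, hΛ⟩
  · rintro ⟨⟨α, hα | hα⟩, hΛ⟩
    · exact ⟨_, hα, hΛ⟩
    · exact ⟨⟨-α, Or.inl hα⟩, hα, map_hElt_neg_eq_zero P _ hα hΛ⟩
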